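/- Let $m\ge 1$. Let $|\mathbf x\rangle$, $\mathbf x\in\{0,1\}^m$, be the occupation basis of the Fock space of $m$ fermionic modes, with annihilation operators given by $a_i|\mathbf x\rangle=0$ if $x_i=0$ and $a_i|\mathbf x\rangle=(-1)^{\sum_{j<i}x_j}|\mathbf x'\rangle$ if $x_i=1$, where $\mathbf x'$ is $\mathbf x$ with $x_i$ replaced by $0$. Let $\gamma_{2i-1}=a_i+a_i^\dagger$ and $\gamma_{2i}=-\mathrm i(a_i-a_i^\dagger)$, $1\le i\le m$, be the $2m$ Majorana operators, and call an operator even if it is a linear combination of products of an even number of Majorana operators. For each permutation $\mathbf p$ of $\{1,\dots,2m\}$ let $U(\mathbf p)$ be a unitary with $U(\mathbf p)\gamma_kU(\mathbf p)^\dagger=\gamma_{\mathbf p(k)}$ for all $k$ (it exists and is unique up to a phase, which plays no role). The affine-matchgate ensemble $\mathcal U$ is $U(\mathbf p)$ with $\mathbf p$ uniformly random among the $(2m)!$ permutations. Its measurement channel is $$\mathcal M(\rho)=\frac1{(2m)!}\sum_{\mathbf p}\sum_{\mathbf b\in\{0,1\}^m}\operatorname{tr}\!\big(\rho\,U(\mathbf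 p)^\dagger|\mathbf b\rangle\langle\mathbf b|U(\mathbf p)\big)\,U(\mathbf p)^\dagger|\mathbf b\rangle\langle\mathbf b|U(\mathbf p).$$ The channel $\mathcal M$ restricts to a bijection of the space of even operators onto itself, and every $U(\mathbf p)^\dagger|\mathbf b\rangle\langle\mathbf b|U(\mathbf p)$ is even. Write $\mathcal M^{-1}$ for the inverse on even operators. For an observable $O$ put $\hat o(\mathbf p,\mathbf b)=\operatorname{tr}\!\big(O\,\mathcal M^{-1}(U(\mathbf p)^\dagger|\mathbf b\rangle\langle\mathbf b|U(\mathbf p))\big)$, and define the shadow norm of $O$ by $$\|O\|_{\mathcal U}^2=\max_{\sigma}\ \frac1{(2m)!}\sum_{\mathbf p}\sum_{\mathbf b}\langle\mathbf b|U(\mathbf p)\,\sigma\,U(\mathbf p)^\dagger|\mathbf b\rangle\,|\hat o(\mathbf p,\mathbf b)|^2,$$ the maximum being over all density operators $\sigma$ (positive semidefinite, trace one). For $O=|\mathbf 0\rangle\langle\mathbf 0|$, the projector onto the vacuum $|0\cdots0\rangle$, this maximum is attained, and $$\big\|\,|\mathbf 0\rangle\langle\mathbf 0|\,\big\|_{\mathcal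 U}\le\sqrt{2m}.$$ -/

import Mathlib

open scoped ComplexOrder

noncomputable section

namespace AffineMatchgate

/-- Occupation strings `x ∈ {0,1}^m`; they label the computational basis states `|x⟩` of an
`m`-mode fermionic system. -/
abbrev Occ (m : ℕ) : Type := Fin m → Bool

/-- Operators on the `2^m`-dimensional Fock space, as matrices in the occupation basis. -/
abbrev Op (m : ℕ) : Type := Matrix (Occ m) (Occ m) ℂ

/-- The projector `|b⟩⟨b|` onto a computational basis state. -/
def basisProj {m : ℕ} (b : Occ m) : Op m := Matrix.single b b 1

/-- The projector onto the vacuum `|0…0⟩`. -/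
def vacuumProj (m : ℕ) : Op m := basisProj fun _ => false

/-- The annihilation operator of mode `i`: `a_i |y⟩ = 0` if `y_i = 0`, and
`a_i |y⟩ = (-1)^(∑_{j<i} y_j) |y with y_i replaced by 0⟩` if `y_i = 1`. -/
def annihilation {m : ℕ} (i : Fin m) : Op m :=
  Matrix.of fun x y =>
    if y i = true ∧ x = Function.update y i false then
      (-1) ^ (∑ j ∈ Finset.Iio i, (y j).toNat)
    else 0

/-- The mode of the (zero-based) Majorana index `k`. -/
def modeOf {m : ℕ} (k : Fin (2 * m)) : Fin m := ⟨k.1 / 2, by omega⟩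

/-- The `2m` single-mode Majorana operators, indexed from `0`: in one-based notation
`γ_{2i-1} = a_i + a_i†` and `γ_{2i} = -i (a_i - a_i†)`. -/
def majorana {m : ℕ} (k : Fin (2 * m)) : Op m :=
  if k.1 % 2 = 0 then
    annihilation (modeOf k) + (annihilation (modeOf k)).conjTranspose
  else
    (-Complex.I) • (annihilation (modeOf k) - (annihilation (modeOf k)).conjTranspose)

/-- The Majorana operator `Γ_μ = (-i)^(k choose 2) γ_{μ_1} ⋯ γ_{μ_k}` of the increasing sequence
`μ_1 < ⋯ < μ_k` that lists the set `S`. -/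
def majoranaString {m : ℕ} (S : Finset (Fin (2 * m))) : Op m :=
  (-Complex.I) ^ (S.card.choose 2) • ((S.sort (· ≤ ·)).map majorana).prod

/-- The space of even operators, spanned by the Majorana operators of even degree. -/
def evenOps (m : ℕ) : Submodule ℂ (Op m) :=
  Submodule.span ℂ (majoranaString '' {S : Finset (Fin (2 * m)) | Even S.card})

/-! ### Existence of the unitaries that permute the Majorana operators -/

section existence

variable {m : ℕ}

/-- The basis state reached from `y` by flipping mode `i`. -/
def flipBit (i : Fin m) (y : Occ m) : Occ m := Function.update y i (!y i)

/-- The sign `(-1)^(∑_{j<i} y_j)`. -/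
def stringSign (i : Fin m) (y : Occ m) : ℂ := (-1) ^ (∑ j ∈ Finset.Iio i, (y j).toNat)

/-- The phase in `γ_k |y⟩ = phase • |flip y⟩`. -/
def majoranaPhase (k : Fin (2 * m)) (y : Occ m) : ℂ :=
  (if k.1 % 2 = 0 then 1 else if y (modeOf k) then -Complex.I else Complex.I) *
    stringSign (modeOf k) y

theorem flipBit_flipBit (i : Fin m) (y : Occ m) : flipBit i (flipBit i y) = y := by
  simp [flipBit]

theorem flipBit_comm (i j : Fin m) (y : Occ m) :
    flipBit i (flipBit j y) = flipBit j (flipBit i y) := by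
  by_cases h : i = j
  · rw [h]
  · funext l
    simp only [flipBit, Function.update_apply]
    grind

theorem stringSign_flipBit (i j : Fin m) (y : Occ m) :
    stringSign i (flipBit j y) = (if j < i then -1 else 1) * stringSign i y := by
  unfold stringSign
  by_cases h : j < i
  · have hj : j ∈ Finset.Iio i := by simpa using h
    rw [← Finset.add_sum_erase _ _ hj, ← Finset.add_sum_erase (Finset.Iio i) _ hj]
    have : ∑ x ∈ (Finset.Iio i).erase j, (flipBit j y x).toNat =
        ∑ x ∈ (Finset.Iio i).erase j, (y x).toNat := by
      apply Finset.sum_congr rfl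
      intro x hx
      simp [flipBit, Function.update_of_ne (Finset.ne_of_mem_erase hx)]
    rw [this, pow_add, pow_add]
    cases hy : y j <;> simp [flipBit, hy, h]
  · have : ∑ x ∈ Finset.Iio i, (flipBit j y x).toNat = ∑ x ∈ Finset.Iio i, (y x).toNat := by
      apply Finset.sum_congr rfl
      intro x hx
      have hx' : x ≠ j := by
        rintro rfl
        exact h (by simpa using hx)
      simp [flipBit, Function.update_of_ne hx']
    rw [this]
    simp [h]

theorem stringSign_mul_self (i : Fin m) (y : Occ m) : stringSign i y * stringSign i y = 1 := by
  unfold stringSign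
  rw [← pow_add, ← two_mul, pow_mul]
  simp

theorem star_stringSign (i : Fin m) (y : Occ m) : star (stringSign i y) = stringSign i y := by
  simp [stringSign]

theorem annihilation_apply (i : Fin m) (x y : Occ m) :
    annihilation i x y = if x = flipBit i y then (if y i then stringSign i y else 0) else 0 := by
  unfold annihilation flipBit stringSign
  cases hy : y i <;> simp [hy]

theorem annihilation_star_apply (i : Fin m) (x y : Occ m) :
    (annihilation i).conjTranspose x y =
      if x = flipBit i y then (if y i then 0 else stringSign i y) else 0 := by
  rw [Matrix.conjTranspose_apply, annihilation_apply]
  by_cases h : x = flipBit i y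
  · have h' : y = flipBit i x := by rw [h, flipBit_flipBit]
    subst h
    rw [if_pos h', if_pos rfl, stringSign_flipBit]
    cases hy : y i <;> simp [flipBit, hy, stringSign]
  · have h' : ¬ y = flipBit i x := by
      rintro rfl
      exact h (flipBit_flipBit i x).symm
    simp [h, h']

theorem majorana_apply (k : Fin (2 * m)) (x y : Occ m) :
    majorana k x y = if x = flipBit (modeOf k) y then majoranaPhase k y else 0 := by
  unfold majorana majoranaPhase
  by_cases hk : k.1 % 2 = 0
  · simp only [hk, if_true, Matrix.add_apply, annihilation_apply, annihilation_star_apply]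
    by_cases h : x = flipBit (modeOf k) y <;> cases hy : y (modeOf k) <;> simp [h]
  · simp only [hk, if_false, Matrix.smul_apply, Matrix.sub_apply, annihilation_apply,
      annihilation_star_apply]
    by_cases h : x = flipBit (modeOf k) y <;> cases hy : y (modeOf k) <;> simp [h]

theorem majorana_mul_apply (k l : Fin (2 * m)) (x y : Occ m) :
    (majorana k * majorana l) x y =
      if x = flipBit (modeOf k) (flipBit (modeOf l) y) then
        majoranaPhase k (flipBit (modeOf l) y) * majoranaPhase l y else 0 := by
  rw [Matrix.mul_apply]
  simp only [majorana_apply]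
  rw [Finset.sum_eq_single (flipBit (modeOf l) y)]
  · simp
  · intro z _ hz
    simp [hz]
  · simp

theorem majorana_mul_self (k : Fin (2 * m)) : majorana k * majorana k = 1 := by
  ext x y
  rw [majorana_mul_apply, flipBit_flipBit, Matrix.one_apply]
  by_cases h : x = y
  · rw [if_pos h, if_pos h]
    unfold majoranaPhase
    rw [stringSign_flipBit, mul_mul_mul_comm, mul_assoc _ (stringSign _ _), stringSign_mul_self]
    by_cases hk : k.1 % 2 = 0
    · simp [hk]
    · cases hy : y (modeOf k) <;> simp [hk, flipBit, hy]
  · simp [h]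

theorem majorana_anticomm {k l : Fin (2 * m)} (h : k ≠ l) :
    majorana k * majorana l = -(majorana l * majorana k) := by
  ext x y
  rw [Matrix.neg_apply, majorana_mul_apply, majorana_mul_apply, flipBit_comm]
  by_cases hx : x = flipBit (modeOf l) (flipBit (modeOf k) y)
  · rw [if_pos hx, if_pos hx]
    unfold majoranaPhase
    rw [stringSign_flipBit, stringSign_flipBit]
    by_cases hm : modeOf k = modeOf l
    · have hpar : k.1 % 2 ≠ l.1 % 2 := by
        intro h2
        apply h
        have h3 : k.1 / 2 = l.1 / 2 := by simpa [modeOf] using hm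
        apply Fin.ext
        omega
      rw [hm]
      by_cases hk : k.1 % 2 = 0
      · have hl : ¬ l.1 % 2 = 0 := by omega
        cases hy : y (modeOf l) <;> simp [hk, hl, flipBit, hy] <;> ring
      · have hl : l.1 % 2 = 0 := by omega
        cases hy : y (modeOf l) <;> simp [hk, hl, flipBit, hy] <;> ring
    · have h1 : flipBit (modeOf l) y (modeOf k) = y (modeOf k) := by
        simp [flipBit, Function.update_of_ne hm]
      have h2 : flipBit (modeOf k) y (modeOf l) = y (modeOf l) := by
        simp [flipBit, Function.update_of_ne (Ne.symm hm)]
      rw [h1, h2]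
      rcases lt_or_gt_of_ne hm with hlt | hlt
      · simp only [hlt, not_lt_of_gt hlt, if_true, if_false]
        ring
      · simp only [hlt, not_lt_of_gt hlt, if_true, if_false]
        ring
  · simp [hx]

theorem majorana_star (k : Fin (2 * m)) : star (majorana k) = majorana k := by
  rw [Matrix.star_eq_conjTranspose]
  unfold majorana
  split_ifs
  · simp [add_comm]
  · rw [Matrix.conjTranspose_smul, Matrix.conjTranspose_sub, Matrix.conjTranspose_conjTranspose]
    simp only [star_neg, Complex.star_def, Complex.conj_I, neg_neg]
    rw [← neg_sub, smul_neg, neg_smul]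

/-- The fermion parity operator `∑_x (-1)^(∑_j x_j) |x⟩⟨x|`. -/
def parityOp (m : ℕ) : Op m := Matrix.diagonal fun x => (-1) ^ (∑ j, (x j).toNat)

theorem parityOp_mul_self : parityOp m * parityOp m = 1 := by
  unfold parityOp
  rw [Matrix.diagonal_mul_diagonal, ← Matrix.diagonal_one]
  congr 1
  funext x
  rw [← pow_add, ← two_mul, pow_mul]
  simp

theorem parityOp_star : star (parityOp m) = parityOp m := by
  rw [Matrix.star_eq_conjTranspose]
  unfold parityOp
  rw [Matrix.diagonal_conjTranspose]
  congr 1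
  funext x
  simp

theorem parityOp_majorana (k : Fin (2 * m)) :
    parityOp m * majorana k = -(majorana k * parityOp m) := by
  ext x y
  unfold parityOp
  rw [Matrix.neg_apply, Matrix.diagonal_mul, Matrix.mul_diagonal, majorana_apply]
  by_cases h : x = flipBit (modeOf k) y
  · rw [if_pos h, h]
    have hj : modeOf k ∈ (Finset.univ : Finset (Fin m)) := Finset.mem_univ _
    rw [← Finset.add_sum_erase _ _ hj, ← Finset.add_sum_erase Finset.univ (fun j => (y j).toNat) hj]
    have : ∑ x ∈ Finset.univ.erase (modeOf k), (flipBit (modeOf k) y x).toNat =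
        ∑ x ∈ Finset.univ.erase (modeOf k), (y x).toNat := by
      apply Finset.sum_congr rfl
      intro x hx
      simp [flipBit, Function.update_of_ne (Finset.ne_of_mem_erase hx)]
    rw [this, pow_add, pow_add]
    cases hy : y (modeOf k) <;> simp [flipBit, hy] <;> ring
  · simp [h]

theorem exists_swap_unitary (i j : Fin (2 * m)) (hij : i ≠ j) :
    ∃ U : Matrix.unitaryGroup (Occ m) ℂ, ∀ k,
      (U : Op m) * majorana k * star (U : Op m) = majorana (Equiv.swap i j k) := by
  set P := parityOp m with hP
  set V : Op m := majorana i - majorana j with hV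
  set c : ℂ := (((√2)⁻¹ : ℝ) : ℂ) with hc
  have hcc : c * c = 1 / 2 := by
    rw [hc, ← Complex.ofReal_mul, ← mul_inv, Real.mul_self_sqrt (by norm_num)]
    norm_num
  have hcstar : star c = c := by simp [hc]
  have hVstar : star V = V := by rw [hV, star_sub, majorana_star, majorana_star]
  have hVV : V * V = (2 : ℂ) • (1 : Op m) := by
    rw [hV, sub_mul, mul_sub, mul_sub, majorana_mul_self, majorana_mul_self,
      majorana_anticomm hij, two_smul]
    abel
  have hVk : ∀ k, V * majorana k = -(majorana (Equiv.swap i j k) * V) := by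
    intro k
    by_cases h1 : k = i
    · subst h1
      rw [Equiv.swap_apply_left, hV, sub_mul, mul_sub, majorana_mul_self, majorana_mul_self]
      abel
    · by_cases h2 : k = j
      · subst h2
        rw [Equiv.swap_apply_right, hV, sub_mul, mul_sub, majorana_mul_self, majorana_mul_self]
        abel
      · rw [Equiv.swap_apply_of_ne_of_ne h1 h2, hV, sub_mul, mul_sub,
          majorana_anticomm (Ne.symm h1), majorana_anticomm (Ne.symm h2)]
        abel
  have hstar : star (c • (P * V)) = c • (V * P) := by
    rw [star_smul, star_mul, hVstar, hP, parityOp_star, hcstar]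
  have key : ∀ A : Op m, (c • (P * V)) * A * (c • (V * P)) =
      (1 / 2 : ℂ) • (P * (V * A * V) * P) := by
    intro A
    rw [smul_mul_assoc, smul_mul_assoc, mul_smul_comm, smul_smul, hcc]
    simp only [mul_assoc]
  refine ⟨⟨c • (P * V), ?_⟩, ?_⟩
  · rw [Matrix.mem_unitaryGroup_iff, hstar]
    have := key 1
    rw [mul_one, mul_one, hVV] at this
    rw [this, mul_smul_comm, mul_one, smul_mul_assoc, hP, parityOp_mul_self, smul_smul]
    norm_num
  · intro k
    change (c • (P * V)) * majorana k * star (c • (P * V)) = _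
    rw [hstar, key, hVk, neg_mul, mul_assoc _ V V, hVV, mul_smul_comm, mul_one, mul_neg,
      mul_smul_comm, hP, parityOp_majorana, neg_mul, smul_mul_assoc, neg_mul, smul_neg, smul_neg,
      smul_neg, neg_neg, mul_assoc, parityOp_mul_self, mul_one, smul_smul]
    norm_num

theorem exists_perm_unitary (p : Equiv.Perm (Fin (2 * m))) :
    ∃ U : Matrix.unitaryGroup (Occ m) ℂ, ∀ k,
      (U : Op m) * majorana k * star (U : Op m) = majorana (p k) := by
  induction p using Equiv.Perm.swap_induction_on with
  | one => exact ⟨1, fun k => by simp⟩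
  | swap_mul f x y hxy ih =>
    obtain ⟨U, hU⟩ := ih
    obtain ⟨W, hW⟩ := exists_swap_unitary x y hxy
    refine ⟨W * U, fun k => ?_⟩
    rw [Equiv.Perm.mul_apply, ← hW, ← hU]
    simp only [Submonoid.coe_mul, star_mul, mul_assoc]

end existence

/-! ### The affine-matchgate ensemble and its shadow norm -/

/-- The unitary `U(p)` of the affine-matchgate ensemble attached to the permutation `p` of the
`2m` Majorana operators: `U(p) γ_k U(p)† = γ_{p(k)}`, which fixes `U(p)` up to a phase. No
definition below depends on the phase. -/
def gateUnitary {m : ℕ} (p : Equiv.Perm (Fin (2 * m))) : Matrix.unitaryGroup (Occ m) ℂ :=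
  Classical.choose (exists_perm_unitary p)

theorem gateUnitary_spec {m : ℕ} (p : Equiv.Perm (Fin (2 * m))) (k : Fin (2 * m)) :
    (gateUnitary p : Op m) * majorana k * star (gateUnitary p : Op m) = majorana (p k) :=
  Classical.choose_spec (exists_perm_unitary p) k

/-- The snapshot `U(p)† |b⟩⟨b| U(p)`. -/
def snapshot {m : ℕ} (p : Equiv.Perm (Fin (2 * m))) (b : Occ m) : Op m :=
  star (gateUnitary p : Op m) * basisProj b * (gateUnitary p : Op m)

/-- The measurement channel
`M(ρ) = |U|⁻¹ ∑_{U, b} tr(ρ U†|b⟩⟨b|U) U†|b⟩⟨b|U`, with `U = U(p)` and `p` uniform among the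
`(2m)!` permutations. -/
def channel (m : ℕ) : Op m →ₗ[ℂ] Op m :=
  ((Fintype.card (Equiv.Perm (Fin (2 * m))) : ℂ)⁻¹) •
    ∑ p : Equiv.Perm (Fin (2 * m)), ∑ b : Occ m,
      ((Matrix.traceLinearMap (Occ m) ℂ ℂ).comp
        (LinearMap.mulRight ℂ (snapshot p b))).smulRight (snapshot p b)

theorem channel_apply {m : ℕ} (ρ : Op m) :
    channel m ρ = ((Fintype.card (Equiv.Perm (Fin (2 * m))) : ℂ)⁻¹) •
      ∑ p : Equiv.Perm (Fin (2 * m)), ∑ b : Occ m,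
        (ρ * snapshot p b).trace • snapshot p b := by
  simp [channel]

/-- The inverse `M⁻¹` of the channel on the even operators, the space on which the channel is
invertible (and which contains all snapshots). -/
def channelInv (m : ℕ) : Op m → Op m :=
  Function.invFunOn (channel m) (evenOps m : Set (Op m))

/-- The value `ô = tr(O M⁻¹(U(p)†|b⟩⟨b|U(p)))` of the estimator of `O`. -/
def estimator {m : ℕ} (O : Op m) (p : Equiv.Perm (Fin (2 * m))) (b : Occ m) : ℂ :=
  (O * channelInv m (snapshot p b)).trace

/-- `σ` is a normalized state (a density operator). -/
def IsState {m : ℕ} (σ : Op m) : Prop := σ.PosSemidef ∧ σ.trace = 1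

/-- The second moment `E[|ô|²]` in the state `σ`: the permutation `p` is uniform, and given `p` the
outcome `b` has probability `⟨b|U(p) σ U(p)†|b⟩ = tr(σ U(p)†|b⟩⟨b|U(p))`. For Hermitian `O` the
estimator is real, and this is `E[ô²]`. -/
def secondMoment {m : ℕ} (O σ : Op m) : ℝ :=
  (Fintype.card (Equiv.Perm (Fin (2 * m))) : ℝ)⁻¹ *
    ∑ p : Equiv.Perm (Fin (2 * m)), ∑ b : Occ m,
      (σ * snapshot p b).trace.re * ‖estimator O p b‖ ^ 2

/-- The root mean squares of the estimator of `O` over all normalized states. -/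
def rmsValues {m : ℕ} (O : Op m) : Set ℝ :=
  {r | ∃ σ : Op m, IsState σ ∧ r = √(secondMoment O σ)}

/-- The shadow norm of `O`: the largest root mean square of its estimator over all normalized
states. -/
def shadowNorm {m : ℕ} (O : Op m) : ℝ := sSup (rmsValues O)

end AffineMatchgate

end

namespace AffineMatchgate

/-! ### Estimates with central binomial coefficients -/

/-! Conjugation by `U(p)` sends a Majorana string on `S` to plus or minus the string on `p(S)`. A
string is diagonal if its index set is a union of mode pairs, and otherwise has zero diagonal. Hence
the channel acts on each string as a scalar, the probability `P(S)` that `p(S)` is paired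
(`channel_majoranaString`). This is positive for even `|S|`, which gives invertibility on the even
operators.

The vacuum projector is `2^(-m) ∑_T Z_T` with `Z_T` a product of Pauli `Z`s, so its preimage has
coefficients `2^(-m) / P(T)`. The channel is symmetric for the trace form, so the estimator is a
diagonal entry of the conjugated preimage. Only the `T` kept paired by `p` contribute, and
conjugating back leaves a diagonal operator with entries `w_p(x)` (`diagonal_estimator_vacuumProj`).
The second moment in `σ` is therefore the average of the mean of `w_p(x)^2` over the diagonal of
`σ`. Since `w_p` is a signed sum with positive coefficients and all signs are `+1` at the vacuum,
the vacuum state is a maximizer.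

The maximum is `4^(-m) ∑_{T,T'} P(T,T') / (P(T) P(T'))`, where `P(T,T')` is the probability that
both sets stay paired. Counting colorings expresses these probabilities through `D(n) = (2n)!/n!`
(`card_perm_exists_coloring`). With `r(n) = 4^n / (2n choose n)`, the double sum is at most `A * B /
r(m)`, where `A = ∑ (m choose k) r(k)` and `B = ∑ (m choose k) r(k) r(m-k)`
(`sum_pair_dblFactorialRatio_le`). The bounds `3n+1 ≤ r(n)^2 ≤ 4n+1` then give `4^m * 2m` for `m ≥
3`; the cases `m = 1, 2` are computed. -/

theorem sum_centralBinom_mul_centralBinom (n : ℕ) :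
    ∑ x ∈ Finset.HasAntidiagonal.antidiagonal n, x.1.centralBinom * x.2.centralBinom = 4 ^ n := by
  induction n with
  | zero => simp
  | succ n ih =>
    -- Swapping the two indices shows that the mean first index is `N / 2`. With the recursion for
    -- central binomials this yields `(n+1) S(n+1) = 4 (n+1) S(n)`, without generating functions.
    have hsymm : ∀ N : ℕ, 2 * ∑ x ∈ Finset.HasAntidiagonal.antidiagonal N,
        x.1 * (x.1.centralBinom * x.2.centralBinom) =
        N * ∑ x ∈ Finset.HasAntidiagonal.antidiagonal N, x.1.centralBinom * x.2.centralBinom := by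
      intro N
      rw [two_mul]
      nth_rewrite 2 [← Finset.Nat.sum_antidiagonal_swap]
      rw [← Finset.sum_add_distrib, Finset.mul_sum]
      refine Finset.sum_congr rfl fun x hx => ?_
      rw [← Finset.HasAntidiagonal.mem_antidiagonal.1 hx]
      simp only [Prod.fst_swap, Prod.snd_swap]
      ring
    have h1 := hsymm (n + 1)
    have h2 : ∑ x ∈ Finset.HasAntidiagonal.antidiagonal (n + 1), x.1 * (x.1.centralBinom * x.2.centralBinom) =
        2 * (2 * ∑ x ∈ Finset.HasAntidiagonal.antidiagonal n, x.1 * (x.1.centralBinom * x.2.centralBinom)) +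
        2 * ∑ x ∈ Finset.HasAntidiagonal.antidiagonal n, x.1.centralBinom * x.2.centralBinom := by
      rw [Finset.Nat.sum_antidiagonal_succ]
      simp only [zero_mul, zero_add, Finset.mul_sum]
      rw [← Finset.sum_add_distrib]
      refine Finset.sum_congr rfl fun x _ => ?_
      rw [← mul_assoc, Nat.succ_mul_centralBinom_succ]
      ring
    rw [h2, hsymm n, ih] at h1
    have h3 : (n + 1) * ∑ x ∈ Finset.HasAntidiagonal.antidiagonal (n + 1), x.1.centralBinom * x.2.centralBinom =
        (n + 1) * 4 ^ (n + 1) := by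
      rw [← h1]; ring
    exact Nat.eq_of_mul_eq_mul_left (Nat.succ_pos n) h3

/-- The left side is a single term of Vandermonde's identity for the right side. -/
theorem centralBinom_mul_le (a b : ℕ) :
    a.centralBinom * b.centralBinom ≤ (a + b).centralBinom := by
  simp only [Nat.centralBinom]
  rw [mul_add, Nat.add_choose_eq]
  exact Finset.single_le_sum (f := fun ij : ℕ × ℕ => (2 * a).choose ij.1 * (2 * b).choose ij.2)
    (fun _ _ => Nat.zero_le _) (Finset.HasAntidiagonal.mem_antidiagonal.2 rfl : (a, b) ∈ _)

theorem three_mul_add_one_mul_centralBinom_sq_le (n : ℕ) :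
    (3 * n + 1) * n.centralBinom ^ 2 ≤ 16 ^ n := by
  induction n with
  | zero => simp
  | succ n ih =>
    have h := Nat.succ_mul_centralBinom_succ n
    refine Nat.le_of_mul_le_mul_left (c := (n + 1) ^ 2) ?_ (by positivity)
    calc (n + 1) ^ 2 * ((3 * (n + 1) + 1) * (n + 1).centralBinom ^ 2)
        = (3 * n + 4) * ((n + 1) * (n + 1).centralBinom) ^ 2 := by ring
      _ = (4 * (3 * n + 4) * (2 * n + 1) ^ 2) * n.centralBinom ^ 2 := by rw [h]; ring
      -- The two polynomial factors differ by exactly `4 * n`.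
      _ ≤ (16 * (n + 1) ^ 2 * (3 * n + 1)) * n.centralBinom ^ 2 := by gcongr ?_ * _; nlinarith
      _ = 16 * (n + 1) ^ 2 * ((3 * n + 1) * n.centralBinom ^ 2) := by ring
      _ ≤ 16 * (n + 1) ^ 2 * 16 ^ n := by gcongr
      _ = (n + 1) ^ 2 * 16 ^ (n + 1) := by ring

theorem sixteen_pow_le_mul_centralBinom_sq (n : ℕ) :
    16 ^ n ≤ (4 * n + 1) * n.centralBinom ^ 2 := by
  induction n with
  | zero => simp
  | succ n ih =>
    have h := Nat.succ_mul_centralBinom_succ n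
    refine Nat.le_of_mul_le_mul_left (c := (n + 1) ^ 2) ?_ (by positivity)
    calc (n + 1) ^ 2 * 16 ^ (n + 1) = 16 * (n + 1) ^ 2 * 16 ^ n := by ring
      _ ≤ 16 * (n + 1) ^ 2 * ((4 * n + 1) * n.centralBinom ^ 2) := by gcongr
      _ = (16 * (n + 1) ^ 2 * (4 * n + 1)) * n.centralBinom ^ 2 := by ring
      -- The two polynomial factors differ by exactly `4`.
      _ ≤ (4 * (4 * n + 5) * (2 * n + 1) ^ 2) * n.centralBinom ^ 2 := by gcongr ?_ * _; nlinarith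
      _ = (4 * n + 5) * ((n + 1) * (n + 1).centralBinom) ^ 2 := by rw [h]; ring
      _ = (n + 1) ^ 2 * ((4 * (n + 1) + 1) * (n + 1).centralBinom ^ 2) := by ring

/-- The ratio `4^n / (2n choose n)`, which grows like `√(π n)`. -/
noncomputable def binomRatio (n : ℕ) : ℝ := 4 ^ n / n.centralBinom

theorem binomRatio_pos (n : ℕ) : 0 < binomRatio n := by
  have := n.centralBinom_pos
  unfold binomRatio
  positivity

theorem binomRatio_sq_le (n : ℕ) : binomRatio n ^ 2 ≤ 4 * n + 1 := by
  have := n.centralBinom_pos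
  have h := sixteen_pow_le_mul_centralBinom_sq n
  rw [binomRatio, div_pow, div_le_iff₀ (by positivity), ← pow_mul, mul_comm n 2, pow_mul]
  norm_num
  exact_mod_cast h

theorem le_binomRatio_sq (n : ℕ) : 3 * n + 1 ≤ binomRatio n ^ 2 := by
  have := n.centralBinom_pos
  have h := three_mul_add_one_mul_centralBinom_sq_le n
  rw [binomRatio, div_pow, le_div_iff₀ (by positivity), ← pow_mul, mul_comm n 2, pow_mul]
  norm_num
  exact_mod_cast h

theorem sum_choose_mul_four_mul_add_one (m : ℕ) :
    ∑ k ∈ Finset.range (m + 1), (m.choose k : ℝ) * (4 * k + 1) = 2 ^ m * (2 * m + 1) := by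
  have h1 : ∑ k ∈ Finset.range (m + 1), (m.choose k : ℝ) = 2 ^ m := by
    exact_mod_cast Nat.sum_range_choose m
  have h2 : 2 * ∑ k ∈ Finset.range (m + 1), (m.choose k : ℝ) * k = m * 2 ^ m := by
    rw [two_mul]
    nth_rewrite 2 [← Finset.sum_range_reflect]
    rw [← Finset.sum_add_distrib, ← h1, Finset.mul_sum]
    refine Finset.sum_congr rfl fun k hk => ?_
    have hk' : k ≤ m := Nat.lt_succ_iff.1 (Finset.mem_range.1 hk)
    rw [Nat.add_sub_cancel, Nat.choose_symm hk', Nat.cast_sub hk']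
    ring
  calc ∑ k ∈ Finset.range (m + 1), (m.choose k : ℝ) * (4 * k + 1)
      = 4 * ∑ k ∈ Finset.range (m + 1), (m.choose k : ℝ) * k +
          ∑ k ∈ Finset.range (m + 1), (m.choose k : ℝ) := by
        rw [Finset.mul_sum, ← Finset.sum_add_distrib]
        exact Finset.sum_congr rfl fun k _ => by ring
    _ = _ := by rw [h1]; linear_combination 2 * h2

/-- Cauchy–Schwarz with binomial weights, combined with `binomRatio_sq_le`. -/
theorem sum_choose_mul_binomRatio_sq_le (m : ℕ) :
    (∑ k ∈ Finset.range (m + 1), (m.choose k : ℝ) * binomRatio k) ^ 2 ≤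
      4 ^ m * (2 * m + 1) := by
  calc (∑ k ∈ Finset.range (m + 1), (m.choose k : ℝ) * binomRatio k) ^ 2
      ≤ (∑ k ∈ Finset.range (m + 1), (m.choose k : ℝ)) *
          ∑ k ∈ Finset.range (m + 1), (m.choose k : ℝ) * (4 * k + 1) := by
        refine Finset.sum_sq_le_sum_mul_sum_of_sq_le_mul _ (fun _ _ => by positivity)
          (fun _ _ => by positivity) fun k _ => ?_
        have := binomRatio_sq_le k
        calc ((m.choose k : ℝ) * binomRatio k) ^ 2 =
            (m.choose k : ℝ) * ((m.choose k : ℝ) * binomRatio k ^ 2) := by ring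
          _ ≤ _ := by gcongr
    _ = 4 ^ m * (2 * m + 1) := by
        have h1 : ∑ k ∈ Finset.range (m + 1), (m.choose k : ℝ) = 2 ^ m := by
          exact_mod_cast Nat.sum_range_choose m
        rw [h1, sum_choose_mul_four_mul_add_one, show (4 : ℝ) = 2 * 2 by norm_num, mul_pow]
        ring

/-- By the arithmetic-geometric mean inequality, each product of two ratios is at most `((4k+1) +
(4(m-k)+1)) / 2 = 2m+1`. -/
theorem sum_choose_mul_binomRatio_mul_le (m : ℕ) :
    ∑ k ∈ Finset.range (m + 1), (m.choose k : ℝ) * (binomRatio k * binomRatio (m - k)) ≤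
      2 ^ m * (2 * m + 1) := by
  have h1 : ∑ k ∈ Finset.range (m + 1), (m.choose k : ℝ) = 2 ^ m := by
    exact_mod_cast Nat.sum_range_choose m
  rw [← h1, Finset.sum_mul]
  refine Finset.sum_le_sum fun k hk => ?_
  have hk' : k ≤ m := Nat.lt_succ_iff.1 (Finset.mem_range.1 hk)
  gcongr
  have h2 := binomRatio_sq_le k
  have h3 := binomRatio_sq_le (m - k)
  rw [Nat.cast_sub hk'] at h3
  nlinarith [sq_nonneg (binomRatio k - binomRatio (m - k))]

theorem sum_mul_sum_binomRatio_le (m : ℕ) (hm : 1 ≤ m) :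
    (∑ k ∈ Finset.range (m + 1), (m.choose k : ℝ) * binomRatio k) *
      ((∑ k ∈ Finset.range (m + 1), (m.choose k : ℝ) * (binomRatio k * binomRatio (m - k))) /
        binomRatio m) ≤ 4 ^ m * (2 * m) := by
  -- The general argument needs `(2m+1)^3 ≤ (2m)^2 (3m+1)`, which fails for `m = 1, 2` and holds
  -- from `m = 3` on.
  rcases (by omega : m = 1 ∨ m = 2 ∨ 3 ≤ m) with rfl | rfl | h3
  · norm_num [Finset.sum_range_succ, binomRatio, Nat.centralBinom, Nat.choose]
  · norm_num [Finset.sum_range_succ, binomRatio, Nat.centralBinom, Nat.choose]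
  · have hr := binomRatio_pos m
    set A := ∑ k ∈ Finset.range (m + 1), (m.choose k : ℝ) * binomRatio k
    set B := ∑ k ∈ Finset.range (m + 1), (m.choose k : ℝ) * (binomRatio k * binomRatio (m - k))
    have hA : A ^ 2 ≤ 4 ^ m * (2 * m + 1) := sum_choose_mul_binomRatio_sq_le m
    have hB : B ≤ 2 ^ m * (2 * m + 1) := sum_choose_mul_binomRatio_mul_le m
    have hB0 : 0 ≤ B := Finset.sum_nonneg fun k _ => by
      have := binomRatio_pos k
      have := binomRatio_pos (m - k)
      positivity
    have hm3 : (3 : ℝ) ≤ m := by exact_mod_cast h3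
    rw [← mul_div_assoc, div_le_iff₀ hr]
    refine le_of_sq_le_sq ?_ (by positivity)
    calc (A * B) ^ 2 = A ^ 2 * B ^ 2 := by ring
      _ ≤ (4 ^ m * (2 * m + 1)) * (2 ^ m * (2 * m + 1) : ℝ) ^ 2 := by gcongr
      _ = 16 ^ m * (2 * m + 1 : ℝ) ^ 3 := by
        rw [show (16 : ℝ) ^ m = 4 ^ m * (2 ^ m * 2 ^ m) by simp only [← mul_pow]; norm_num]; ring
      _ ≤ 16 ^ m * ((2 * m) ^ 2 * (3 * m + 1)) := by gcongr; nlinarith [sq_nonneg ((m : ℝ) - 3)]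
      _ ≤ 16 ^ m * ((2 * m) ^ 2 * binomRatio m ^ 2) := by gcongr; exact le_binomRatio_sq m
      _ = (4 ^ m * (2 * m) * binomRatio m) ^ 2 := by
        rw [show (16 : ℝ) ^ m = 4 ^ m * 4 ^ m by simp only [← mul_pow]; norm_num]; ring

/-! ### Factorial quotients and the double sum over mode sets. -/

/-- The quotient `(2n)! / n!`. -/
noncomputable def dblFactorialRatio (n : ℕ) : ℝ := ((2 * n).factorial : ℝ) / n.factorial

theorem dblFactorialRatio_pos (n : ℕ) : 0 < dblFactorialRatio n := by
  unfold dblFactorialRatio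
  positivity

theorem dblFactorialRatio_eq (n : ℕ) :
    dblFactorialRatio n = n.factorial * (4 ^ n / binomRatio n) := by
  have h := Nat.choose_mul_factorial_mul_factorial (n := 2 * n) (k := n) (by omega)
  rw [show 2 * n - n = n by omega] at h
  have := n.centralBinom_pos
  unfold dblFactorialRatio binomRatio
  rw [← h, Nat.centralBinom]
  push_cast
  field_simp

/-- Both sides equal `(2a choose a) (2(n-a) choose n-a) / (2n choose n)`. The right-hand form can be
bounded by `1` termwise and summed over `a` in closed form. -/
theorem choose_mul_dblFactorialRatio {n a : ℕ} (h : a ≤ n) :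
    (n.choose a : ℝ) * (dblFactorialRatio a * dblFactorialRatio (n - a) / dblFactorialRatio n) =
      binomRatio n / (binomRatio a * binomRatio (n - a)) := by
  have h1 : ((n.choose a * a.factorial * (n - a).factorial : ℕ) : ℝ) = n.factorial := by
    rw [Nat.choose_mul_factorial_mul_factorial h]
  push_cast at h1
  have h2 : (4 : ℝ) ^ n = 4 ^ a * 4 ^ (n - a) := by rw [← pow_add, Nat.add_sub_cancel' h]
  have := binomRatio_pos n
  have := binomRatio_pos a
  have := binomRatio_pos (n - a)
  have := n.factorial_pos
  rw [dblFactorialRatio_eq, dblFactorialRatio_eq, dblFactorialRatio_eq, ← h1, h2]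
  have hc : (n.choose a : ℝ) ≠ 0 := by exact_mod_cast (Nat.choose_pos h).ne'
  field_simp

/-- The reciprocal form of the preceding identity. The common binomial factor is kept on both sides
and cancelled where the lemma is used. -/
theorem choose_mul_dblFactorialRatio' {n a : ℕ} (h : a ≤ n) :
    (n.choose a : ℝ) * (dblFactorialRatio n / (dblFactorialRatio a * dblFactorialRatio (n - a))) =
      (n.choose a : ℝ) * ((n.choose a : ℝ) * (binomRatio a * binomRatio (n - a)) / binomRatio n) := by
  have h1 := choose_mul_dblFactorialRatio h
  have := binomRatio_pos n
  have := binomRatio_pos a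
  have := binomRatio_pos (n - a)
  have := dblFactorialRatio_pos n
  have := dblFactorialRatio_pos a
  have := dblFactorialRatio_pos (n - a)
  congr 1
  field_simp at h1 ⊢
  linear_combination -h1

theorem binomRatio_div_le_one {n a : ℕ} (h : a ≤ n) :
    binomRatio n / (binomRatio a * binomRatio (n - a)) ≤ 1 := by
  have h1 : ((a.centralBinom * (n - a).centralBinom : ℕ) : ℝ) ≤ n.centralBinom := by
    have := centralBinom_mul_le a (n - a)
    rw [Nat.add_sub_cancel' h] at this
    exact_mod_cast this
  push_cast at h1
  have := binomRatio_pos a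
  have := binomRatio_pos (n - a)
  have h2 : (4 : ℝ) ^ n = 4 ^ a * 4 ^ (n - a) := by rw [← pow_add, Nat.add_sub_cancel' h]
  have := n.centralBinom_pos
  have := a.centralBinom_pos
  have := (n - a).centralBinom_pos
  rw [div_le_one (by positivity), binomRatio, binomRatio, binomRatio, div_mul_div_comm, ← h2]
  gcongr

/-- This is the convolution identity `sum_centralBinom_mul_centralBinom`, normalized. -/
theorem sum_binomRatio_div (n : ℕ) :
    ∑ a ∈ Finset.range (n + 1), binomRatio n / (binomRatio a * binomRatio (n - a)) =
      binomRatio n := by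
  have h := sum_centralBinom_mul_centralBinom n
  rw [Finset.Nat.sum_antidiagonal_eq_sum_range_succ
    (fun i j => i.centralBinom * j.centralBinom)] at h
  have h' : ∑ a ∈ Finset.range (n + 1), ((a.centralBinom : ℝ) * (n - a).centralBinom) = 4 ^ n := by
    exact_mod_cast h
  have h4 : ∑ a ∈ Finset.range (n + 1), (1 : ℝ) / (binomRatio a * binomRatio (n - a)) = 1 := by
    refine Eq.trans ?_ (div_self (show (4 : ℝ) ^ n ≠ 0 by positivity))
    nth_rewrite 1 [← h']
    rw [Finset.sum_div]
    refine Finset.sum_congr rfl fun a ha => ?_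
    have h2 : (4 : ℝ) ^ n = 4 ^ a * 4 ^ (n - a) := by
      rw [← pow_add, Nat.add_sub_cancel' (Nat.lt_succ_iff.1 (Finset.mem_range.1 ha))]
    have := a.centralBinom_pos
    have := (n - a).centralBinom_pos
    rw [binomRatio, binomRatio, h2]
    field_simp
  calc _ = binomRatio n * ∑ a ∈ Finset.range (n + 1),
        (1 : ℝ) / (binomRatio a * binomRatio (n - a)) := by
        rw [Finset.mul_sum]
        exact Finset.sum_congr rfl fun a _ => by ring
    _ = _ := by rw [h4, mul_one]

theorem sum_inter_sdiff {α : Type*} [Fintype α] [DecidableEq α] (T : Finset α)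
    (F : ℕ → ℕ → ℝ) :
    ∑ T' : Finset α, F (T ∩ T').card (T' \ T).card =
      ∑ a ∈ Finset.range (T.card + 1), ∑ c ∈ Finset.range (Tᶜ.card + 1),
        (T.card.choose a : ℝ) * (Tᶜ.card.choose c : ℝ) * F a c := by
  have h1 : ∑ T' : Finset α, F (T ∩ T').card (T' \ T).card =
      ∑ x ∈ T.powerset ×ˢ Tᶜ.powerset, F x.1.card x.2.card := by
    refine Finset.sum_bij' (fun T' _ => (T ∩ T', T' \ T)) (fun x _ => x.1 ∪ x.2) ?_ ?_ ?_ ?_ ?_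
    · intro T' _
      simp only [Finset.mem_product, Finset.mem_powerset]
      exact ⟨Finset.inter_subset_left, fun x hx => by simp at hx ⊢; exact hx.2⟩
    · simp
    · intro T' _
      ext x
      simp only [Finset.mem_union, Finset.mem_inter, Finset.mem_sdiff]
      tauto
    · rintro ⟨A, C⟩ hx
      simp only [Finset.mem_product, Finset.mem_powerset] at hx
      have hC : ∀ x ∈ C, x ∉ T := fun x hx' => by simpa using hx.2 hx'
      ext x
      · have := @hx.1 x
        have := hC x
        simp only [Finset.mem_union, Finset.mem_inter]
        tauto
      · have := @hx.1 x
        have := hC x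
        simp only [Finset.mem_union, Finset.mem_sdiff]
        tauto
    · simp
  rw [h1, Finset.sum_product]
  have h2 := fun c : ℕ => Finset.sum_powerset_apply_card (fun c' => F c c') (x := Tᶜ)
  simp only [h2]
  rw [Finset.sum_powerset_apply_card
    (fun a => ∑ c ∈ Finset.range (Tᶜ.card + 1), Tᶜ.card.choose c • F a c) (x := T)]
  simp only [nsmul_eq_mul, Finset.mul_sum, mul_assoc]

/-- The summand is `P(T,T') / (P(T) P(T'))` with common factors cancelled. It depends on `T'` only
through `a = |T ∩ T'|` and `c = |T' \ T|`. For fixed `T`, the `c`-factor is bounded by `1`, which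
leaves a partial sum of `w` over the sizes `a + c`; the `a`-factor is summed exactly. -/
theorem sum_pair_dblFactorialRatio_le (m : ℕ) (hm : 1 ≤ m) :
    ∑ T : Finset (Fin m), ∑ T' : Finset (Fin m),
      (dblFactorialRatio (T ∩ T').card * dblFactorialRatio (T.card - (T ∩ T').card) /
          dblFactorialRatio T.card) *
        (dblFactorialRatio (T' \ T).card * dblFactorialRatio (Tᶜ.card - (T' \ T).card) /
          dblFactorialRatio Tᶜ.card) *
        (dblFactorialRatio m / (dblFactorialRatio T'.card * dblFactorialRatio (m - T'.card))) ≤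
      4 ^ m * (2 * m) := by
  set w : ℕ → ℝ := fun l =>
    dblFactorialRatio m / (dblFactorialRatio l * dblFactorialRatio (m - l)) with hw
  have hw0 : ∀ l, 0 ≤ w l := fun l => by
    have := dblFactorialRatio_pos m
    have := dblFactorialRatio_pos l
    have := dblFactorialRatio_pos (m - l)
    simp only [hw]
    positivity
  set W := (∑ k ∈ Finset.range (m + 1),
    (m.choose k : ℝ) * (binomRatio k * binomRatio (m - k))) / binomRatio m with hW
  have hwW : ∑ l ∈ Finset.range (m + 1), w l = W := by
    rw [hW, Finset.sum_div]
    refine Finset.sum_congr rfl fun l hl => ?_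
    have hl' : l ≤ m := Nat.lt_succ_iff.1 (Finset.mem_range.1 hl)
    have hc : (m.choose l : ℝ) ≠ 0 := by exact_mod_cast (Nat.choose_pos hl').ne'
    exact mul_left_cancel₀ hc (choose_mul_dblFactorialRatio' hl')
  have hinner : ∀ T : Finset (Fin m), ∑ T' : Finset (Fin m),
      (dblFactorialRatio (T ∩ T').card * dblFactorialRatio (T.card - (T ∩ T').card) /
          dblFactorialRatio T.card) *
        (dblFactorialRatio (T' \ T).card * dblFactorialRatio (Tᶜ.card - (T' \ T).card) /
          dblFactorialRatio Tᶜ.card) * w T'.card ≤ binomRatio T.card * W := by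
    intro T
    have hcard : ∀ T' : Finset (Fin m), T'.card = (T ∩ T').card + (T' \ T).card := by
      intro T'
      rw [Finset.inter_comm, Finset.card_inter_add_card_sdiff]
    have hT : T.card + Tᶜ.card = m := by simp [Finset.card_add_card_compl]
    set F : ℕ → ℕ → ℝ := fun a c =>
      (dblFactorialRatio a * dblFactorialRatio (T.card - a) / dblFactorialRatio T.card) *
        (dblFactorialRatio c * dblFactorialRatio (Tᶜ.card - c) / dblFactorialRatio Tᶜ.card) *
        w (a + c) with hF
    calc _ = ∑ T' : Finset (Fin m), F (T ∩ T').card (T' \ T).card := by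
          refine Finset.sum_congr rfl fun T' _ => ?_
          rw [hcard T']
      _ = ∑ a ∈ Finset.range (T.card + 1), ∑ c ∈ Finset.range (Tᶜ.card + 1),
          (binomRatio T.card / (binomRatio a * binomRatio (T.card - a))) *
          ((binomRatio Tᶜ.card / (binomRatio c * binomRatio (Tᶜ.card - c))) * w (a + c)) := by
          rw [sum_inter_sdiff]
          refine Finset.sum_congr rfl fun a ha => Finset.sum_congr rfl fun c hc => ?_
          rw [← choose_mul_dblFactorialRatio (Nat.lt_succ_iff.1 (Finset.mem_range.1 ha)),
            ← choose_mul_dblFactorialRatio (Nat.lt_succ_iff.1 (Finset.mem_range.1 hc))]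
          ring
      _ ≤ ∑ a ∈ Finset.range (T.card + 1),
          (binomRatio T.card / (binomRatio a * binomRatio (T.card - a))) * W := by
          refine Finset.sum_le_sum fun a ha => ?_
          have ha' : a ≤ T.card := Nat.lt_succ_iff.1 (Finset.mem_range.1 ha)
          rw [← Finset.mul_sum]
          have := binomRatio_pos T.card
          have := binomRatio_pos a
          have := binomRatio_pos (T.card - a)
          gcongr
          -- The sizes `a + c` fill an interval inside `{0, …, m}`, so the nonnegative sum is at
          -- most the full sum `W`, a bound independent of `a`.
          calc _ ≤ ∑ c ∈ Finset.range (Tᶜ.card + 1), w (a + c) :=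
                Finset.sum_le_sum fun c hc => mul_le_of_le_one_left (hw0 _)
                  (binomRatio_div_le_one (Nat.lt_succ_iff.1 (Finset.mem_range.1 hc)))
            _ = ∑ l ∈ Finset.Ico a (a + (Tᶜ.card + 1)), w l := by
                rw [Finset.sum_Ico_eq_sum_range, Nat.add_sub_cancel_left]
            _ ≤ ∑ l ∈ Finset.range (m + 1), w l := by
                refine Finset.sum_le_sum_of_subset_of_nonneg ?_ fun _ _ _ => hw0 _
                intro l hl
                rw [Finset.mem_Ico] at hl
                rw [Finset.mem_range]
                omega
            _ = W := hwW
      _ = binomRatio T.card * W := by rw [← Finset.sum_mul, sum_binomRatio_div]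
  calc _ ≤ ∑ T : Finset (Fin m), binomRatio T.card * W := Finset.sum_le_sum fun T _ => hinner T
    _ = (∑ k ∈ Finset.range (m + 1), (m.choose k : ℝ) * binomRatio k) * W := by
        rw [← Finset.sum_mul, ← Finset.powerset_univ, Finset.sum_powerset_apply_card]
        simp
    _ ≤ _ := sum_mul_sum_binomRatio_le m hm

/-! ### Counting permutations that respect the modes -/

theorem exists_perm_comp_eq {α κ : Type*} [Fintype α] [DecidableEq κ] {f g : α → κ}
    (h : ∀ i, Fintype.card {a // f a = i} = Fintype.card {a // g a = i}) :
    ∃ e : Equiv.Perm α, g ∘ e = f :=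
  ⟨Equiv.ofFiberEquiv fun i => Fintype.equivOfCardEq (h i),
    funext fun a => Equiv.ofFiberEquiv_map _ a⟩

/-- If some permutation `e` solves the equation, the solutions form a coset of the stabilizer of the
coloring, whose order is the product of the factorials of the fiber sizes. A solution exists exactly
when the fiber sizes agree. -/
theorem card_perm_comp_eq {α κ : Type*} [Fintype α] [DecidableEq α] [Fintype κ] [DecidableEq κ]
    (f g : α → κ) :
    Fintype.card {p : Equiv.Perm α // g ∘ p = f} =
      if ∀ i, Fintype.card {a // f a = i} = Fintype.card {a // g a = i} then
        ∏ i, (Fintype.card {a // f a = i}).factorial else 0 := by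
  split_ifs with h
  · obtain ⟨e, rfl⟩ := exists_perm_comp_eq h
    rw [← DomMulAct.stabilizer_card]
    refine Fintype.card_congr ⟨fun p => ⟨e⁻¹ * p.1, ?_⟩, fun p => ⟨e * p.1, ?_⟩, ?_, ?_⟩
    · funext a
      simpa using congrFun p.2 a
    · funext a
      exact congrFun p.2 a
    · intro p
      simp
    · intro p
      simp
  · rw [Fintype.card_eq_zero_iff]
    refine ⟨fun p => h fun i => ?_⟩
    refine Fintype.card_congr (p.1.subtypeEquiv fun a => ?_)
    rw [← congrFun p.2 a]
    rfl

section pairs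

variable {m : ℕ}

/-- The set of the Majorana indices of the modes in `T`. -/
def modePairs (T : Finset (Fin m)) : Finset (Fin (2 * m)) :=
  Finset.univ.filter fun k => modeOf k ∈ T

@[simp] theorem mem_modePairs {T : Finset (Fin m)} {k : Fin (2 * m)} :
    k ∈ modePairs T ↔ modeOf k ∈ T := by simp [modePairs]

theorem card_modeOf_eq (j : Fin m) :
    (Finset.univ.filter fun k : Fin (2 * m) => modeOf k = j).card = 2 := by
  have hj := j.2
  rw [Finset.card_eq_two]
  refine ⟨⟨2 * j.1, by omega⟩, ⟨2 * j.1 + 1, by omega⟩, by simp, ?_⟩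
  ext k
  simp only [Finset.mem_filter_univ, Finset.mem_insert, Finset.mem_singleton, modeOf, Fin.ext_iff]
  omega

theorem modeOf_surjective : Function.Surjective (modeOf (m := m)) := by
  intro j
  have h : (Finset.univ.filter fun k : Fin (2 * m) => modeOf k = j).Nonempty := by
    rw [← Finset.card_pos, card_modeOf_eq]
    norm_num
  obtain ⟨k, hk⟩ := h
  exact ⟨k, by simpa using hk⟩

theorem card_modePairs (T : Finset (Fin m)) : (modePairs T).card = 2 * T.card := by
  rw [Finset.card_eq_sum_card_fiberwise (f := modeOf) (t := T) (fun k hk => by simpa using hk),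
    Finset.sum_congr rfl (g := fun _ => 2), Finset.sum_const, smul_eq_mul, mul_comm]
  intro j hj
  refine Eq.trans (congrArg Finset.card ?_) (card_modeOf_eq j)
  ext k
  simp only [Finset.mem_filter, mem_modePairs, Finset.mem_univ, true_and, and_iff_right_iff_imp]
  rintro rfl
  exact hj

theorem card_fiber_comp_modeOf {κ : Type*} [DecidableEq κ] (χ : Fin m → κ) (i : κ) :
    Fintype.card {k : Fin (2 * m) // (χ ∘ modeOf) k = i} =
      2 * Fintype.card {j // χ j = i} := by
  rw [Fintype.card_subtype, Fintype.card_subtype, ← card_modePairs]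
  congr 1
  ext k
  simp

/-- Both the permutations of the `2m` indices and those of the `m` modes are sorted by the coloring
`χ'` of the modes that they carry back to `χ`. The two counts are nonzero for the same `χ'`, with
constant values `∏ (2 n_i)!` and `∏ n_i!`, where `n_i` are the fiber sizes of `χ`. Comparing them
term by term avoids counting the admissible `χ'`. -/
theorem card_perm_exists_coloring {κ : Type*} [Fintype κ] [DecidableEq κ] (χ : Fin m → κ) :
    (Fintype.card {p : Equiv.Perm (Fin (2 * m)) // ∃ χ' : Fin m → κ,
        (χ' ∘ modeOf) ∘ p = χ ∘ modeOf}) * ∏ i, (Fintype.card {j // χ j = i}).factorial =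
      m.factorial * ∏ i, (2 * Fintype.card {j // χ j = i}).factorial := by
  have hA : Fintype.card {p : Equiv.Perm (Fin (2 * m)) // ∃ χ' : Fin m → κ,
      (χ' ∘ modeOf) ∘ p = χ ∘ modeOf} = ∑ χ' : Fin m → κ,
      Fintype.card {p : Equiv.Perm (Fin (2 * m)) // (χ' ∘ modeOf) ∘ p = χ ∘ modeOf} := by
    rw [← Fintype.card_sigma]
    refine (Fintype.card_congr (Equiv.ofBijective (fun x => ⟨x.2.1, x.1, x.2.2⟩) ⟨?_, ?_⟩)).symm
    · rintro ⟨χ₁, p₁, h₁⟩ ⟨χ₂, p₂, h₂⟩ h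
      obtain rfl : p₁ = p₂ := congrArg Subtype.val h
      -- A permutation determines its coloring, because both `modeOf` and the permutation are
      -- surjective.
      obtain rfl : χ₁ = χ₂ := by
        rw [← h₂] at h₁
        exact modeOf_surjective.injective_comp_right (p₁.surjective.injective_comp_right h₁)
      rfl
    · rintro ⟨p, χ', h⟩
      exact ⟨⟨χ', p, h⟩, rfl⟩
  -- Each permutation `q` of the modes belongs to exactly one coloring, namely `χ ∘ q⁻¹`.
  have hB : m.factorial = ∑ χ' : Fin m → κ,
      Fintype.card {p : Equiv.Perm (Fin m) // χ' ∘ p = χ} := by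
    have h1 := Fintype.card_perm (α := Fin m)
    rw [Fintype.card_fin] at h1
    rw [← h1, ← Fintype.card_congr
      (Equiv.sigmaFiberEquiv fun p : Equiv.Perm (Fin m) => χ ∘ p.symm), Fintype.card_sigma]
    refine Finset.sum_congr rfl fun χ' _ =>
      Fintype.card_congr (Equiv.subtypeEquivRight fun p => ?_)
    rw [Equiv.comp_symm_eq]
    exact eq_comm
  rw [hA, hB, Finset.sum_mul, Finset.sum_mul]
  refine Finset.sum_congr rfl fun χ' _ => ?_
  rw [card_perm_comp_eq, card_perm_comp_eq]
  simp only [card_fiber_comp_modeOf, Nat.mul_right_inj (show (2 : ℕ) ≠ 0 by norm_num)]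
  split_ifs
  · exact mul_comm _ _
  · simp

theorem card_perm_exists_coloring_div {κ : Type*} [Fintype κ] [DecidableEq κ] (χ : Fin m → κ) :
    (Fintype.card {p : Equiv.Perm (Fin (2 * m)) // ∃ χ' : Fin m → κ,
        (χ' ∘ modeOf) ∘ p = χ ∘ modeOf} : ℝ) / Fintype.card (Equiv.Perm (Fin (2 * m))) =
      (∏ i, dblFactorialRatio (Fintype.card {j // χ j = i})) / dblFactorialRatio m := by
  have h := congrArg (Nat.cast (R := ℝ)) (card_perm_exists_coloring χ)
  push_cast at h
  rw [Fintype.card_perm, Fintype.card_fin]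
  unfold dblFactorialRatio
  rw [Finset.prod_div_distrib]
  have h1 : ∏ i, ((Fintype.card {j // χ j = i}).factorial : ℝ) ≠ 0 :=
    Finset.prod_ne_zero_iff.2 fun i _ => by positivity
  field_simp
  linear_combination h

/-! ### Probabilities that index sets become paired. -/

/-- `S` is a union of the pairs of Majorana indices of modes. -/
def IsPaired (S : Finset (Fin (2 * m))) : Prop := ∃ T : Finset (Fin m), S = modePairs T

theorem isPaired_map_modePairs_iff (p : Equiv.Perm (Fin (2 * m))) (T : Finset (Fin m)) :
    IsPaired ((modePairs T).map p.toEmbedding) ↔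
      ∃ T' : Finset (Fin m), ∀ k, modeOf (p k) ∈ T' ↔ modeOf k ∈ T := by
  refine exists_congr fun T' => ?_
  rw [Finset.ext_iff]
  refine ⟨fun h k => ?_, fun h k => ?_⟩
  · have := h (p k)
    simp only [Finset.mem_map_equiv, mem_modePairs, Equiv.symm_apply_apply] at this
    exact this.symm
  · have := h (p.symm k)
    simp only [Finset.mem_map_equiv, mem_modePairs, Equiv.apply_symm_apply] at this ⊢
    exact this.symm

open Classical in
/-- The probability that a random permutation maps `S` to a union of pairs. -/
noncomputable def pairedProb (S : Finset (Fin (2 * m))) : ℝ :=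
  (Fintype.card {p : Equiv.Perm (Fin (2 * m)) // IsPaired (S.map p.toEmbedding)} : ℝ) /
    Fintype.card (Equiv.Perm (Fin (2 * m)))

theorem pairedProb_modePairs (T : Finset (Fin m)) :
    pairedProb (modePairs T) =
      dblFactorialRatio T.card * dblFactorialRatio (m - T.card) / dblFactorialRatio m := by
  classical
  -- Staying paired means that the two-coloring by membership in `T` is carried to another coloring
  -- of modes.
  have h := card_perm_exists_coloring_div fun j : Fin m => decide (j ∈ T)
  have h1 : ∏ i, dblFactorialRatio (Fintype.card {j // decide (j ∈ T) = i}) =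
      dblFactorialRatio T.card * dblFactorialRatio (m - T.card) := by
    rw [Fintype.prod_bool, Fintype.card_subtype, Fintype.card_subtype]
    congr 2
    · simp
    · refine Eq.trans (congrArg Finset.card ?_) ((Finset.card_compl T).trans (by simp))
      ext; simp
  rw [← h1, ← h, pairedProb]
  congr 2
  refine Fintype.card_congr (Equiv.subtypeEquivRight fun p => ?_)
  rw [isPaired_map_modePairs_iff]
  refine ⟨fun ⟨T', hT'⟩ => ⟨fun j => decide (j ∈ T'), ?_⟩, fun ⟨χ, hχ⟩ =>
    ⟨Finset.univ.filter fun j => χ j = true, fun k => ?_⟩⟩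
  · funext k
    simp [hT' k]
  · have := congrFun hχ k
    simp only [Function.comp_apply] at this
    simp [this]

open Classical in
theorem pairedProb_modePairs_both (T T' : Finset (Fin m)) :
    (Fintype.card {p : Equiv.Perm (Fin (2 * m)) // IsPaired ((modePairs T).map p.toEmbedding) ∧
        IsPaired ((modePairs T').map p.toEmbedding)} : ℝ) /
      Fintype.card (Equiv.Perm (Fin (2 * m))) =
      (dblFactorialRatio (T ∩ T').card * dblFactorialRatio (T.card - (T ∩ T').card)) *
        (dblFactorialRatio (T' \ T).card * dblFactorialRatio (Tᶜ.card - (T' \ T).card)) /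
          dblFactorialRatio m := by
  -- Both sets stay paired exactly when the four-coloring by joint membership is carried to a
  -- coloring of modes.
  have h := card_perm_exists_coloring_div fun j : Fin m => (decide (j ∈ T), decide (j ∈ T'))
  have h1 : ∏ i, dblFactorialRatio
      (Fintype.card {j // (decide (j ∈ T), decide (j ∈ T')) = i}) =
      (dblFactorialRatio (T ∩ T').card * dblFactorialRatio (T.card - (T ∩ T').card)) *
        (dblFactorialRatio (T' \ T).card * dblFactorialRatio (Tᶜ.card - (T' \ T).card)) := by
    rw [Fintype.prod_prod_type, Fintype.prod_bool, Fintype.prod_bool, Fintype.prod_bool]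
    simp only [Fintype.card_subtype]
    congr 3
    · congr 1
      ext; simp
    · rw [← Finset.card_sdiff_of_subset Finset.inter_subset_left]
      congr 1
      ext; simp
    · congr 1
      ext; simp [and_comm]
    · rw [← Finset.card_sdiff_of_subset (fun x hx => by simp at hx ⊢; exact hx.2)]
      congr 1
      ext; simp; tauto
  rw [← h1, ← h]
  congr 2
  refine Fintype.card_congr (Equiv.subtypeEquivRight fun p => ?_)
  rw [isPaired_map_modePairs_iff, isPaired_map_modePairs_iff]
  refine ⟨fun ⟨⟨A, hA⟩, ⟨B, hB⟩⟩ => ⟨fun j => (decide (j ∈ A), decide (j ∈ B)), ?_⟩,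
    fun ⟨χ, hχ⟩ => ⟨⟨Finset.univ.filter fun j => (χ j).1 = true, fun k => ?_⟩,
      ⟨Finset.univ.filter fun j => (χ j).2 = true, fun k => ?_⟩⟩⟩
  · funext k
    simp [hA k, hB k]
  · have := congrFun hχ k
    simp only [Function.comp_apply] at this
    simp [this]
  · have := congrFun hχ k
    simp only [Function.comp_apply] at this
    simp [this]

/-- A set of even size `2n` has as many elements as the union of `n` mode pairs, so some permutation
carries it there. -/
theorem pairedProb_pos {S : Finset (Fin (2 * m))} (hS : Even S.card) : 0 < pairedProb S := by
  classical
  obtain ⟨n, hn⟩ := hS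
  have hnm : n ≤ m := by
    have := Finset.card_le_univ S
    rw [Fintype.card_fin] at this
    omega
  obtain ⟨T, -, hT⟩ := Finset.exists_subset_card_eq (s := (Finset.univ : Finset (Fin m)))
    (n := n) (by simpa using hnm)
  have hcard : S.card = (modePairs T).card := by rw [card_modePairs, hT, hn, two_mul]
  obtain ⟨e, he⟩ := exists_perm_comp_eq (f := fun k => decide (k ∈ S))
    (g := fun k => decide (k ∈ modePairs T)) (by
      intro i
      rw [Fintype.card_subtype, Fintype.card_subtype]
      cases i
      · simp only [decide_eq_false_iff_not]
        rw [Finset.filter_not, Finset.filter_not, Finset.card_sdiff_of_subset (by simp),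
          Finset.card_sdiff_of_subset (by simp)]
        rw [Finset.filter_univ_mem, Finset.filter_univ_mem, hcard]
      · simp only [decide_eq_true_eq, Finset.filter_univ_mem, hcard])
  have : 0 < Fintype.card
      {p : Equiv.Perm (Fin (2 * m)) // IsPaired (S.map p.toEmbedding)} := by
    refine Fintype.card_pos_iff.2 ⟨⟨e, T, ?_⟩⟩
    ext k
    have := congrFun he (e.symm k)
    simp only [Function.comp_apply, Equiv.apply_symm_apply, decide_eq_decide] at this
    rw [Finset.mem_map_equiv, this]
  unfold pairedProb
  have := Fintype.card_pos (α := Equiv.Perm (Fin (2 * m)))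
  positivity

end pairs

variable {m : ℕ}

/-! ### Products of Majorana operators -/

/-- The product of the Majorana operators listed by `L`. -/
noncomputable def majoranaProd (L : List (Fin (2 * m))) : Op m := (L.map majorana).prod

@[simp] theorem majoranaProd_nil : majoranaProd ([] : List (Fin (2 * m))) = 1 := rfl

@[simp] theorem majoranaProd_cons (k : Fin (2 * m)) (L : List (Fin (2 * m))) :
    majoranaProd (k :: L) = majorana k * majoranaProd L := by simp [majoranaProd]

theorem majoranaString_eq (S : Finset (Fin (2 * m))) :
    majoranaString S =
      (-Complex.I) ^ (S.card.choose 2) • majoranaProd (S.sort (· ≤ ·)) := rfl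

theorem majoranaProd_perm {L L' : List (Fin (2 * m))} (h : L.Perm L') :
    majoranaProd L = majoranaProd L' ∨ majoranaProd L = -majoranaProd L' := by
  induction h with
  | nil => exact Or.inl rfl
  | cons k _ ih =>
    rcases ih with ih | ih
    · exact Or.inl (by simp [ih])
    · exact Or.inr (by simp [ih])
  | swap k l L =>
    by_cases hkl : k = l
    · exact Or.inl (by rw [hkl])
    · refine Or.inr ?_
      simp only [majoranaProd_cons, ← mul_assoc]
      rw [majorana_anticomm (Ne.symm hkl), neg_mul]
  | trans _ _ ih₁ ih₂ =>
    rcases ih₁ with h₁ | h₁ <;> rcases ih₂ with h₂ | h₂ <;> simp [h₁, h₂]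

/-! ### Conjugation by the ensemble and matrix entries of strings. -/

theorem star_gateUnitary_mul (p : Equiv.Perm (Fin (2 * m))) :
    star (gateUnitary p : Op m) * (gateUnitary p : Op m) = 1 :=
  Unitary.coe_star_mul_self (gateUnitary p)

theorem gateUnitary_conj_majoranaProd (p : Equiv.Perm (Fin (2 * m))) (L : List (Fin (2 * m))) :
    (gateUnitary p : Op m) * majoranaProd L * star (gateUnitary p : Op m) =
      majoranaProd (L.map p) := by
  induction L with
  | nil => simp
  | cons k L ih =>
    rw [List.map_cons, majoranaProd_cons, majoranaProd_cons, ← ih, ← gateUnitary_spec p k]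
    simp only [mul_assoc]
    rw [← mul_assoc (star (gateUnitary p : Op m)), star_gateUnitary_mul, one_mul]

/-- The factors are permuted to those of `p(S)`, and sorting them costs a sign. Only `ε * ε = 1` is
recorded, which suffices to invert the relation. -/
theorem gateUnitary_conj_majoranaString (p : Equiv.Perm (Fin (2 * m)))
    (S : Finset (Fin (2 * m))) :
    ∃ ε : ℂ, ε * ε = 1 ∧
      (gateUnitary p : Op m) * majoranaString S * star (gateUnitary p : Op m) =
        ε • majoranaString (S.map p.toEmbedding) := by
  have hperm : ((S.sort (· ≤ ·)).map p).Perm ((S.map p.toEmbedding).sort (· ≤ ·)) := by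
    rw [List.perm_ext_iff_of_nodup ((Finset.sort_nodup _ _).map p.injective)
      (Finset.sort_nodup _ _)]
    intro k
    simp only [List.mem_map, Finset.mem_sort, Finset.mem_map, Equiv.coe_toEmbedding]
  rw [majoranaString_eq, majoranaString_eq, Finset.card_map, mul_smul_comm, smul_mul_assoc,
    gateUnitary_conj_majoranaProd]
  rcases majoranaProd_perm hperm with h | h
  · exact ⟨1, by simp, by rw [h, one_smul]⟩
  · exact ⟨-1, by simp, by rw [h, smul_neg, neg_one_smul]⟩

/-- Each factor `γ_k` flips exactly the bit of its mode, so a nonzero entry fixes the parity of the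
number of flips of every mode. -/
theorem majoranaProd_apply_ne_zero (L : List (Fin (2 * m))) (x y : Occ m)
    (h : majoranaProd L x y ≠ 0) (j : Fin m) :
    x j = y j ↔ Even (L.countP fun k => modeOf k = j) := by
  induction L generalizing x with
  | nil =>
    have : x = y := by
      by_contra hxy
      exact h (Matrix.one_apply_ne hxy)
    simp [this]
  | cons k L ih =>
    rw [majoranaProd_cons, Matrix.mul_apply] at h
    obtain ⟨z, -, hz⟩ := Finset.exists_ne_zero_of_sum_ne_zero h
    rw [majorana_apply] at hz
    have hx : x = flipBit (modeOf k) z := by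
      by_contra hx
      simp [hx] at hz
    have h2 := ih z (right_ne_zero_of_mul hz)
    rw [List.countP_cons, hx]
    by_cases hj : modeOf k = j
    · subst hj
      simp only [flipBit, Function.update_self, decide_true, if_true]
      rw [Nat.even_add_one, ← h2]
      cases z (modeOf k) <;> cases y (modeOf k) <;> simp
    · simp only [flipBit, Function.update_of_ne (Ne.symm hj), hj, decide_false]
      simpa using h2

theorem majoranaString_apply_ne_zero (S : Finset (Fin (2 * m))) (x y : Occ m)
    (h : majoranaString S x y ≠ 0) (j : Fin m) :
    x j = y j ↔ Even (S.filter fun k => modeOf k = j).card := by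
  rw [majoranaString_eq, Matrix.smul_apply] at h
  rw [majoranaProd_apply_ne_zero _ x y (right_ne_zero_of_mul h) j, ← Multiset.coe_countP,
    Finset.sort_eq, Multiset.countP_eq_card_filter]
  rfl

theorem majoranaString_apply_of_isPaired {S : Finset (Fin (2 * m))} (hS : IsPaired S)
    {x y : Occ m} (hxy : x ≠ y) : majoranaString S x y = 0 := by
  by_contra h
  obtain ⟨T, rfl⟩ := hS
  refine hxy (funext fun j => (majoranaString_apply_ne_zero _ x y h j).2 ?_)
  rw [modePairs, Finset.filter_filter]
  by_cases hj : j ∈ T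
  · have : (Finset.univ.filter fun k : Fin (2 * m) => modeOf k ∈ T ∧ modeOf k = j) =
        Finset.univ.filter fun k : Fin (2 * m) => modeOf k = j := by
      refine Finset.filter_congr fun k _ => and_iff_right_of_imp ?_
      rintro rfl
      exact hj
    rw [this, card_modeOf_eq]
    exact even_two
  · have : (Finset.univ.filter fun k : Fin (2 * m) => modeOf k ∈ T ∧ modeOf k = j) = ∅ := by
      refine Finset.filter_false_of_mem fun k _ => ?_
      rintro ⟨h1, rfl⟩
      exact hj h1
    rw [this]
    simp

/-- A nonzero diagonal entry forces `S` to meet each mode in an even number of its two indices,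
hence in none or both. -/
theorem majoranaString_apply_self {S : Finset (Fin (2 * m))} (hS : ¬ IsPaired S)
    (x : Occ m) : majoranaString S x x = 0 := by
  by_contra h
  refine hS ⟨Finset.univ.filter fun j => ∃ k ∈ S, modeOf k = j, ?_⟩
  ext k
  simp only [mem_modePairs, Finset.mem_filter_univ]
  refine ⟨fun hk => ⟨k, hk, rfl⟩, fun ⟨l, hl, hlk⟩ => ?_⟩
  have heven := (majoranaString_apply_ne_zero _ x x h (modeOf k)).1 rfl
  have hsub : S.filter (fun l => modeOf l = modeOf k) ⊆
      Finset.univ.filter fun l : Fin (2 * m) => modeOf l = modeOf k :=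
    Finset.filter_subset_filter _ (Finset.subset_univ _)
  have hpos : 0 < (S.filter fun l => modeOf l = modeOf k).card :=
    Finset.card_pos.2 ⟨l, Finset.mem_filter.2 ⟨hl, hlk⟩⟩
  have hle := card_modeOf_eq (modeOf k)
  have heq := Finset.eq_of_subset_of_card_le hsub (by
    rw [hle]
    obtain ⟨n, hn⟩ := heven
    omega)
  have hk : k ∈ Finset.univ.filter fun l : Fin (2 * m) => modeOf l = modeOf k := by simp
  rw [← heq] at hk
  exact (Finset.mem_filter.1 hk).1

open Classical in
theorem diagonal_diag_majoranaString (S : Finset (Fin (2 * m))) :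
    Matrix.diagonal (majoranaString S).diag = if IsPaired S then majoranaString S else 0 := by
  ext x y
  by_cases hxy : x = y
  · subst hxy
    split_ifs with hS
    · simp
    · simp [majoranaString_apply_self hS]
  · rw [Matrix.diagonal_apply_ne _ hxy]
    split_ifs with hS
    · rw [majoranaString_apply_of_isPaired hS hxy]
    · rfl

/-! ### The measurement channel on Majorana operators -/

theorem trace_mul_snapshot (ρ : Op m) (p : Equiv.Perm (Fin (2 * m))) (b : Occ m) :
    (ρ * snapshot p b).trace =
      ((gateUnitary p : Op m) * ρ * star (gateUnitary p : Op m)) b b := by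
  rw [snapshot, ← mul_assoc, Matrix.trace_mul_comm, ← mul_assoc, ← mul_assoc, basisProj,
    Matrix.trace_mul_single]
  simp

theorem sum_smul_basisProj (d : Occ m → ℂ) :
    ∑ b, d b • basisProj b = Matrix.diagonal d := by
  ext x y
  simp only [Matrix.sum_apply, Matrix.smul_apply, basisProj, Matrix.single_apply,
    Matrix.diagonal_apply, smul_eq_mul, mul_ite, mul_one, mul_zero]
  rw [Finset.sum_eq_single x (fun b _ hb => if_neg fun h => hb h.1) (by simp)]
  simp

theorem sum_trace_smul_snapshot (ρ : Op m) (p : Equiv.Perm (Fin (2 * m))) :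
    ∑ b : Occ m, (ρ * snapshot p b).trace • snapshot p b =
      star (gateUnitary p : Op m) *
        Matrix.diagonal ((gateUnitary p : Op m) * ρ * star (gateUnitary p : Op m)).diag *
        (gateUnitary p : Op m) := by
  simp only [trace_mul_snapshot]
  rw [← sum_smul_basisProj, Finset.mul_sum, Finset.sum_mul]
  refine Finset.sum_congr rfl fun b _ => ?_
  rw [snapshot, Matrix.diag_apply, mul_smul_comm, smul_mul_assoc]

open Classical in
theorem diagonal_diag_conj_majoranaString (p : Equiv.Perm (Fin (2 * m)))
    (S : Finset (Fin (2 * m))) :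
    Matrix.diagonal
      ((gateUnitary p : Op m) * majoranaString S * star (gateUnitary p : Op m)).diag =
      if IsPaired (S.map p.toEmbedding) then
        (gateUnitary p : Op m) * majoranaString S * star (gateUnitary p : Op m) else 0 := by
  obtain ⟨ε, -, hε⟩ := gateUnitary_conj_majoranaString p S
  rw [hε, Matrix.diag_smul, Matrix.diagonal_smul, diagonal_diag_majoranaString]
  split_ifs <;> simp

theorem star_conj_conj (p : Equiv.Perm (Fin (2 * m))) (A : Op m) :
    star (gateUnitary p : Op m) * ((gateUnitary p : Op m) * A * star (gateUnitary p : Op m)) *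
      (gateUnitary p : Op m) = A := by
  simp only [mul_assoc]
  rw [star_gateUnitary_mul, mul_one, ← mul_assoc, star_gateUnitary_mul, one_mul]

/-- For fixed `p`, measuring takes the diagonal part of the conjugated string and conjugates back.
This returns the string if `p(S)` is paired and zero otherwise. -/
theorem channel_majoranaString (S : Finset (Fin (2 * m))) :
    channel m (majoranaString S) = (pairedProb S : ℂ) • majoranaString S := by
  classical
  have h : ∀ p : Equiv.Perm (Fin (2 * m)),
      ∑ b : Occ m, (majoranaString S * snapshot p b).trace • snapshot p b =
        (if IsPaired (S.map p.toEmbedding) then (1 : ℂ) else 0) • majoranaString S := by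
    intro p
    rw [sum_trace_smul_snapshot, diagonal_diag_conj_majoranaString]
    split_ifs
    · rw [star_conj_conj, one_smul]
    · simp
  rw [channel_apply, Finset.sum_congr rfl fun p _ => h p, ← Finset.sum_smul, Finset.sum_boole,
    smul_smul, pairedProb, Fintype.card_subtype]
  congr 1
  push_cast
  rw [div_eq_inv_mul]

/-! ### Invertibility on the even operators. -/

theorem majoranaString_mem_evenOps {S : Finset (Fin (2 * m))} (hS : Even S.card) :
    majoranaString S ∈ evenOps m := Submodule.subset_span ⟨S, hS, rfl⟩

theorem channel_mem_evenOps {A : Op m} (hA : A ∈ evenOps m) : channel m A ∈ evenOps m := by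
  have h : evenOps m ≤ (evenOps m).comap (channel m) := by
    refine Submodule.span_le.2 ?_
    rintro _ ⟨S, hS, rfl⟩
    change channel m (majoranaString S) ∈ evenOps m
    rw [channel_majoranaString]
    exact Submodule.smul_mem _ _ (majoranaString_mem_evenOps hS)
  exact h hA

theorem evenOps_le_map_channel : evenOps m ≤ (evenOps m).map (channel m) := by
  refine Submodule.span_le.2 ?_
  rintro _ ⟨S, hS, rfl⟩
  refine ⟨(pairedProb S : ℂ)⁻¹ • majoranaString S,
    Submodule.smul_mem _ _ (majoranaString_mem_evenOps hS), ?_⟩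
  rw [map_smul, channel_majoranaString, smul_smul, inv_mul_cancel₀, one_smul]
  exact_mod_cast (pairedProb_pos hS).ne'

theorem bijOn_channel_evenOps :
    Set.BijOn (channel m) (evenOps m : Set (Op m)) (evenOps m : Set (Op m)) := by
  refine ⟨fun A hA => channel_mem_evenOps hA, ?_, fun A hA => evenOps_le_map_channel hA⟩
  have hsurj : Function.Surjective
      ((channel m).restrict (p := evenOps m) (q := evenOps m) fun A hA =>
        channel_mem_evenOps hA) := by
    rintro ⟨A, hA⟩
    obtain ⟨B, hB, hBA⟩ := evenOps_le_map_channel hA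
    exact ⟨⟨B, hB⟩, Subtype.ext hBA⟩
  -- Finite dimension yields injectivity, so linear independence of the strings is not needed.
  have hinj := LinearMap.injective_iff_surjective.2 hsurj
  intro A hA B hB h
  have := @hinj ⟨A, hA⟩ ⟨B, hB⟩ (Subtype.ext h)
  exact congrArg Subtype.val this

theorem star_conj_mem_evenOps (p : Equiv.Perm (Fin (2 * m))) {A : Op m} (hA : A ∈ evenOps m) :
    star (gateUnitary p : Op m) * A * (gateUnitary p : Op m) ∈ evenOps m := by
  set f : Op m →ₗ[ℂ] Op m := (LinearMap.mulRight ℂ (gateUnitary p : Op m)).comp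
    (LinearMap.mulLeft ℂ (star (gateUnitary p : Op m))) with hf
  have h : evenOps m ≤ (evenOps m).comap f := by
    refine Submodule.span_le.2 ?_
    rintro _ ⟨S, hS, rfl⟩
    change star (gateUnitary p : Op m) * majoranaString S * (gateUnitary p : Op m) ∈ evenOps m
    obtain ⟨ε, hε, h⟩ := gateUnitary_conj_majoranaString p (S.map p.symm.toEmbedding)
    have hS' : (S.map p.symm.toEmbedding).map p.toEmbedding = S := by
      ext k
      simp
    rw [hS'] at h
    have h1 : majoranaString S = ε • ((gateUnitary p : Op m) *
        majoranaString (S.map p.symm.toEmbedding) * star (gateUnitary p : Op m)) := by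
      rw [h, smul_smul, hε, one_smul]
    rw [h1, mul_smul_comm, smul_mul_assoc, star_conj_conj]
    exact Submodule.smul_mem _ _ (majoranaString_mem_evenOps (by simpa using hS))
  exact h hA

/-- Symmetry for the trace form lets the inverse channel be moved from the snapshot to the
observable. -/
theorem trace_channel_mul (A B : Op m) :
    (channel m A * B).trace = (A * channel m B).trace := by
  rw [channel_apply, channel_apply]
  simp only [smul_mul_assoc, mul_smul_comm, Matrix.trace_smul, Finset.sum_mul, Finset.mul_sum,
    Matrix.trace_sum, smul_eq_mul]
  refine Finset.sum_congr rfl fun p _ => Finset.sum_congr rfl fun b _ => congrArg _ ?_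
  rw [Matrix.trace_mul_comm (snapshot p b) B, mul_comm]

/-! ### Products of Pauli `Z` operators -/

/-- The sign `(-1)^(∑_{j ∈ T} x_j)`. -/
noncomputable def modeSign (T : Finset (Fin m)) (x : Occ m) : ℝ :=
  ∏ j ∈ T, if x j then -1 else 1

/-- The diagonal operator with entries `(-1)^(∑_{j ∈ T} x_j)`. -/
noncomputable def modeZ (T : Finset (Fin m)) : Op m :=
  Matrix.diagonal fun x => (modeSign T x : ℂ)

theorem abs_modeSign (T : Finset (Fin m)) (x : Occ m) : |modeSign T x| = 1 := by
  rw [modeSign, Finset.abs_prod]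
  refine Finset.prod_eq_one fun j _ => ?_
  split_ifs <;> simp

@[simp] theorem modeSign_vacuum (T : Finset (Fin m)) : modeSign T (fun _ => false) = 1 := by
  simp [modeSign]

theorem modeZ_singleton (j : Fin m) :
    modeZ {j} = (-Complex.I) •
      (majorana ⟨2 * j.1, by omega⟩ * majorana ⟨2 * j.1 + 1, by omega⟩) := by
  have h0 : modeOf (⟨2 * j.1, by omega⟩ : Fin (2 * m)) = j := by
    simp [modeOf]
  have h1 : modeOf (⟨2 * j.1 + 1, by omega⟩ : Fin (2 * m)) = j := by
    apply Fin.ext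
    simp only [modeOf]
    omega
  ext x y
  rw [Matrix.smul_apply, majorana_mul_apply, modeZ, Matrix.diagonal_apply, h0, h1,
    flipBit_flipBit]
  by_cases hxy : x = y
  · subst hxy
    have hs := stringSign_mul_self j x
    have hodd : ¬ (2 * j.1 + 1) % 2 = 0 := by omega
    simp only [if_true, majoranaPhase, h0, h1, stringSign_flipBit, lt_irrefl, if_false, one_mul,
      Nat.mul_mod_right, hodd, modeSign, Finset.prod_singleton, smul_eq_mul]
    cases hx : x j
    · simp only [Bool.false_eq_true, if_false]
      rw [mul_left_comm (stringSign j x), hs]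
      simp
    · simp only [if_true]
      rw [mul_left_comm (stringSign j x), hs]
      simp
  · simp [hxy]

theorem modeZ_mul (S T : Finset (Fin m)) (h : Disjoint S T) :
    modeZ S * modeZ T = modeZ (S ∪ T) := by
  rw [modeZ, modeZ, Matrix.diagonal_mul_diagonal, modeZ]
  congr 1
  funext x
  rw [modeSign, modeSign, modeSign, Finset.prod_union h, Complex.ofReal_mul]

theorem exists_modeZ_eq_majoranaProd (T : Finset (Fin m)) :
    ∃ (L : List (Fin (2 * m))) (c : ℂ), L.Nodup ∧ (∀ k, k ∈ L ↔ modeOf k ∈ T) ∧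
      modeZ T = c • majoranaProd L := by
  induction T using Finset.induction_on with
  | empty => exact ⟨[], 1, by simp, by simp, by simp [modeZ, modeSign]⟩
  | insert j T hj ih =>
    obtain ⟨L, c, hL, hmem, hc⟩ := ih
    have hiff : ∀ k : Fin (2 * m), modeOf k = j ↔
        k = ⟨2 * j.1, by omega⟩ ∨ k = ⟨2 * j.1 + 1, by omega⟩ := by
      intro k
      simp only [modeOf, Fin.ext_iff]
      omega
    refine ⟨⟨2 * j.1, by omega⟩ :: ⟨2 * j.1 + 1, by omega⟩ :: L, -Complex.I * c, ?_, ?_, ?_⟩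
    · rw [List.nodup_cons, List.nodup_cons, List.mem_cons, hmem, hmem,
        (hiff _).2 (Or.inl rfl), (hiff _).2 (Or.inr rfl)]
      exact ⟨by simp [hj], hj, hL⟩
    · intro k
      rw [List.mem_cons, List.mem_cons, hmem, Finset.mem_insert, hiff, or_assoc]
    · rw [Finset.insert_eq, ← modeZ_mul _ _ (by simpa using hj), modeZ_singleton, hc]
      simp only [majoranaProd_cons, smul_mul_assoc, mul_smul_comm, smul_smul, mul_assoc]
      rw [mul_comm c]

/-- The scalar is left unspecified, since eigenvalues of the channel and membership in the even
operators do not depend on it. -/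
theorem exists_modeZ_eq_majoranaString (T : Finset (Fin m)) :
    ∃ c : ℂ, modeZ T = c • majoranaString (modePairs T) := by
  obtain ⟨L, c, hL, hmem, hc⟩ := exists_modeZ_eq_majoranaProd T
  have hperm : L.Perm ((modePairs T).sort (· ≤ ·)) := by
    rw [List.perm_ext_iff_of_nodup hL (Finset.sort_nodup _ _)]
    intro k
    simp [hmem]
  have hI : (-Complex.I) ^ ((modePairs T).card.choose 2) ≠ 0 :=
    pow_ne_zero _ (neg_ne_zero.2 Complex.I_ne_zero)
  rw [hc, majoranaString_eq]
  rcases majoranaProd_perm hperm with h | h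
  · exact ⟨c * ((-Complex.I) ^ ((modePairs T).card.choose 2))⁻¹, by
      rw [smul_smul, mul_assoc, inv_mul_cancel₀ hI, mul_one, h]⟩
  · exact ⟨-c * ((-Complex.I) ^ ((modePairs T).card.choose 2))⁻¹, by
      rw [smul_smul, mul_assoc, inv_mul_cancel₀ hI, mul_one, h, smul_neg, neg_smul]⟩

theorem modeZ_mem_evenOps (T : Finset (Fin m)) : modeZ T ∈ evenOps m := by
  obtain ⟨c, hc⟩ := exists_modeZ_eq_majoranaString T
  rw [hc]
  exact Submodule.smul_mem _ _ (majoranaString_mem_evenOps (by simp [card_modePairs]))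

theorem channel_modeZ (T : Finset (Fin m)) :
    channel m (modeZ T) = (pairedProb (modePairs T) : ℂ) • modeZ T := by
  obtain ⟨c, hc⟩ := exists_modeZ_eq_majoranaString T
  rw [hc, map_smul, channel_majoranaString, smul_comm]

open Classical in
theorem diagonal_diag_conj_modeZ (p : Equiv.Perm (Fin (2 * m))) (T : Finset (Fin m)) :
    Matrix.diagonal
      ((gateUnitary p : Op m) * modeZ T * star (gateUnitary p : Op m)).diag =
      if IsPaired ((modePairs T).map p.toEmbedding) then
        (gateUnitary p : Op m) * modeZ T * star (gateUnitary p : Op m) else 0 := by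
  obtain ⟨c, hc⟩ := exists_modeZ_eq_majoranaString T
  rw [hc, mul_smul_comm, smul_mul_assoc, Matrix.diag_smul, Matrix.diagonal_smul,
    diagonal_diag_conj_majoranaString]
  split_ifs <;> simp

theorem sum_modeSign_mul_modeSign (x y : Occ m) :
    ∑ T : Finset (Fin m), modeSign T x * modeSign T y = if x = y then 2 ^ m else 0 := by
  have h : ∀ T : Finset (Fin m), modeSign T x * modeSign T y =
      ∏ j ∈ T, (if x j then -1 else 1) * (if y j then -1 else 1) := fun T => by
    rw [modeSign, modeSign, Finset.prod_mul_distrib]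
  rw [Finset.sum_congr rfl fun T _ => h T, ← Finset.powerset_univ, ← Finset.prod_one_add]
  split_ifs with hxy
  · subst hxy
    rw [Finset.prod_congr rfl (g := fun _ => (2 : ℝ))]
    · simp
    · intro j _
      split_ifs <;> norm_num
  · obtain ⟨j, hj⟩ := Function.ne_iff.1 hxy
    refine Finset.prod_eq_zero (Finset.mem_univ j) ?_
    cases hx : x j <;> cases hy : y j <;> simp_all

/-- Fourier inversion on `{0,1}^m`: the signs are its characters, and `sum_modeSign_mul_modeSign` is
their orthogonality. -/
theorem basisProj_eq_sum_modeZ (b : Occ m) :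
    basisProj b = ((2 : ℂ) ^ m)⁻¹ • ∑ T : Finset (Fin m), (modeSign T b : ℂ) • modeZ T := by
  ext x y
  rw [Matrix.smul_apply, Matrix.sum_apply, basisProj, Matrix.single_apply]
  by_cases hxy : x = y
  · subst hxy
    simp only [Matrix.smul_apply, modeZ, Matrix.diagonal_apply_eq, smul_eq_mul, and_self]
    have h := congrArg (Complex.ofReal) (sum_modeSign_mul_modeSign b x)
    push_cast at h
    rw [h]
    split_ifs <;> simp
  · have h1 : ¬ (b = x ∧ b = y) := fun h => hxy (h.1.symm.trans h.2)
    simp [h1, modeZ, Matrix.diagonal_apply_ne _ hxy]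

theorem basisProj_mem_evenOps (b : Occ m) : basisProj b ∈ evenOps m := by
  rw [basisProj_eq_sum_modeZ]
  exact Submodule.smul_mem _ _ (Submodule.sum_mem _ fun T _ =>
    Submodule.smul_mem _ _ (modeZ_mem_evenOps T))

theorem snapshot_mem_evenOps (p : Equiv.Perm (Fin (2 * m))) (b : Occ m) :
    snapshot p b ∈ evenOps m :=
  star_conj_mem_evenOps p (basisProj_mem_evenOps b)

/-! ### The estimator of the vacuum projector -/

theorem pairedProb_modePairs_pos (T : Finset (Fin m)) : 0 < pairedProb (modePairs T) :=
  pairedProb_pos (by simp [card_modePairs])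

/-- The preimage of the vacuum projector under the channel. -/
noncomputable def vacuumPreimage (m : ℕ) : Op m :=
  ((2 : ℂ) ^ m)⁻¹ • ∑ T : Finset (Fin m), ((pairedProb (modePairs T))⁻¹ : ℂ) • modeZ T

theorem channel_vacuumPreimage : channel m (vacuumPreimage m) = vacuumProj m := by
  rw [vacuumProj, basisProj_eq_sum_modeZ, vacuumPreimage, map_smul, map_sum]
  refine congrArg _ (Finset.sum_congr rfl fun T _ => ?_)
  have h : (pairedProb (modePairs T) : ℂ) ≠ 0 := by
    exact_mod_cast (pairedProb_modePairs_pos T).ne'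
  rw [map_smul, channel_modeZ, smul_smul, inv_mul_cancel₀ h, modeSign_vacuum, Complex.ofReal_one]

theorem estimator_vacuumProj (p : Equiv.Perm (Fin (2 * m))) (b : Occ m) :
    estimator (vacuumProj m) p b =
      ((gateUnitary p : Op m) * vacuumPreimage m * star (gateUnitary p : Op m)) b b := by
  -- Being a right inverse on the snapshot is the only property of `channelInv` that enters.
  have hinv : channel m (channelInv m (snapshot p b)) = snapshot p b :=
    Function.invFunOn_eq (bijOn_channel_evenOps.surjOn (snapshot_mem_evenOps p b))
  rw [estimator, ← channel_vacuumPreimage, trace_channel_mul, hinv, trace_mul_snapshot]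

open Classical in
/-- The diagonal of the part of the preimage of the vacuum projector that `U(p)` keeps diagonal. -/
noncomputable def vacuumWeight (p : Equiv.Perm (Fin (2 * m))) (x : Occ m) : ℝ :=
  (2 ^ m)⁻¹ * ∑ T : Finset (Fin m), if IsPaired ((modePairs T).map p.toEmbedding) then
    (pairedProb (modePairs T))⁻¹ * modeSign T x else 0

theorem abs_vacuumWeight_le (p : Equiv.Perm (Fin (2 * m))) (x : Occ m) :
    |vacuumWeight p x| ≤ vacuumWeight p fun _ => false := by
  rw [vacuumWeight, vacuumWeight, abs_mul, abs_of_pos (by positivity : (0 : ℝ) < (2 ^ m)⁻¹)]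
  gcongr
  refine (Finset.abs_sum_le_sum_abs _ _).trans (Finset.sum_le_sum fun T _ => ?_)
  have := pairedProb_modePairs_pos T
  split_ifs
  · rw [abs_mul, abs_modeSign, modeSign_vacuum, abs_of_pos (by positivity)]
  · simp

/-- Taking the diagonal after conjugation keeps or kills each `Z_T` as a whole, so the result is the
conjugate of the surviving, still diagonal, part of the preimage. -/
theorem diagonal_estimator_vacuumProj (p : Equiv.Perm (Fin (2 * m))) :
    Matrix.diagonal (fun b => estimator (vacuumProj m) p b) =
      (gateUnitary p : Op m) * Matrix.diagonal (fun x => (vacuumWeight p x : ℂ)) *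
        star (gateUnitary p : Op m) := by
  classical
  have h1 : Matrix.diagonal (fun x => (vacuumWeight p x : ℂ)) =
      ((2 : ℂ) ^ m)⁻¹ • ∑ T : Finset (Fin m), ((pairedProb (modePairs T))⁻¹ : ℂ) •
        if IsPaired ((modePairs T).map p.toEmbedding) then modeZ T else 0 := by
    ext x y
    rw [Matrix.smul_apply, Matrix.sum_apply]
    by_cases hxy : x = y
    · subst hxy
      rw [Matrix.diagonal_apply_eq, vacuumWeight]
      push_cast
      rw [smul_eq_mul]
      refine congrArg _ (Finset.sum_congr rfl fun T _ => ?_)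
      split_ifs <;> simp [modeZ]
    · rw [Matrix.diagonal_apply_ne _ hxy, Finset.sum_eq_zero, smul_zero]
      intro T _
      split_ifs <;> simp [modeZ, Matrix.diagonal_apply_ne _ hxy]
  have h2 : (fun b => estimator (vacuumProj m) p b) =
      ((gateUnitary p : Op m) * vacuumPreimage m * star (gateUnitary p : Op m)).diag :=
    funext fun b => estimator_vacuumProj p b
  rw [h1, h2, vacuumPreimage]
  simp only [mul_smul_comm, smul_mul_assoc, Finset.mul_sum, Finset.sum_mul, Matrix.diag_smul,
    Matrix.diag_sum, Matrix.diagonal_smul]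
  congr 1
  have h3 : ∀ d : Finset (Fin m) → Occ m → ℂ,
      Matrix.diagonal (∑ T, d T) = ∑ T, Matrix.diagonal (d T) := fun d =>
    map_sum (Matrix.diagonalAddMonoidHom (Occ m) ℂ) d Finset.univ
  rw [h3]
  refine Finset.sum_congr rfl fun T _ => ?_
  rw [Matrix.diagonal_smul, diagonal_diag_conj_modeZ]
  split_ifs <;> simp

/-- With `D = U Q U†` the diagonal matrix of estimator values, the left side is `tr(U σ U† D D†) =
tr(σ Q²)`. As `Q` is diagonal, only the diagonal of `σ` matters. -/
theorem sum_trace_mul_norm_estimator_sq (σ : Op m) (p : Equiv.Perm (Fin (2 * m))) :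
    ∑ b : Occ m, (σ * snapshot p b).trace.re * ‖estimator (vacuumProj m) p b‖ ^ 2 =
      ∑ x : Occ m, (σ x x).re * vacuumWeight p x ^ 2 := by
  set U : Op m := (gateUnitary p : Op m) with hU
  set D : Op m := Matrix.diagonal fun b => estimator (vacuumProj m) p b with hD
  set Q : Op m := Matrix.diagonal fun x => (vacuumWeight p x : ℂ) with hQ
  have hDQ : D = U * Q * star U := diagonal_estimator_vacuumProj p
  have hQs : star Q = Q := by
    rw [hQ, Matrix.star_eq_conjTranspose, Matrix.diagonal_conjTranspose]
    congr 1
    funext x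
    simp
  have hUU : star U * U = 1 := star_gateUnitary_mul p
  have hcancel : ∀ A : Op m, star U * (U * A) = A := fun A => by
    rw [← mul_assoc, hUU, one_mul]
  have h1 : (U * σ * star U * (D * star D)).trace = (σ * (Q * Q)).trace := by
    rw [hDQ, star_mul, star_mul, star_star, hQs]
    simp only [mul_assoc, hcancel]
    rw [Matrix.trace_mul_comm]
    simp only [mul_assoc, hUU, mul_one]
  have h2 : (U * σ * star U * (D * star D)).trace.re =
      ∑ b : Occ m, (σ * snapshot p b).trace.re * ‖estimator (vacuumProj m) p b‖ ^ 2 := by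
    rw [hD, Matrix.star_eq_conjTranspose (Matrix.diagonal _), Matrix.diagonal_conjTranspose,
      Matrix.diagonal_mul_diagonal, Matrix.trace, Complex.re_sum]
    refine Finset.sum_congr rfl fun b _ => ?_
    rw [Matrix.diag_apply, Matrix.mul_diagonal, trace_mul_snapshot, Pi.star_apply,
      Complex.star_def, Complex.mul_conj, Complex.normSq_eq_norm_sq, Complex.re_mul_ofReal]
  have h3 : (σ * (Q * Q)).trace.re = ∑ x : Occ m, (σ x x).re * vacuumWeight p x ^ 2 := by
    rw [hQ, Matrix.diagonal_mul_diagonal, Matrix.trace, Complex.re_sum]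
    refine Finset.sum_congr rfl fun x _ => ?_
    rw [Matrix.diag_apply, Matrix.mul_diagonal, ← Complex.ofReal_mul, Complex.re_mul_ofReal, sq]
  rw [← h2, h1, h3]

/-! ### The maximum over states and its bound. -/

/-- The mean over the ensemble of the squared diagonal weight. -/
noncomputable def meanWeightSq (x : Occ m) : ℝ :=
  (Fintype.card (Equiv.Perm (Fin (2 * m))) : ℝ)⁻¹ *
    ∑ p : Equiv.Perm (Fin (2 * m)), vacuumWeight p x ^ 2

theorem secondMoment_vacuumProj (σ : Op m) :
    secondMoment (vacuumProj m) σ = ∑ x : Occ m, (σ x x).re * meanWeightSq x := by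
  rw [secondMoment, Finset.sum_congr rfl fun p _ => sum_trace_mul_norm_estimator_sq σ p,
    Finset.sum_comm, Finset.mul_sum]
  refine Finset.sum_congr rfl fun x _ => ?_
  rw [meanWeightSq, ← Finset.mul_sum]
  ring

theorem meanWeightSq_le (x : Occ m) : meanWeightSq x ≤ meanWeightSq fun _ : Fin m => false := by
  unfold meanWeightSq
  refine mul_le_mul_of_nonneg_left (Finset.sum_le_sum fun p _ => ?_) (by positivity)
  exact sq_le_sq.2 ((abs_vacuumWeight_le p x).trans (le_abs_self _))

theorem isState_vacuumProj : IsState (vacuumProj m) := by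
  refine ⟨?_, ?_⟩
  · rw [vacuumProj, basisProj, ← Matrix.diagonal_single]
    refine Matrix.PosSemidef.diagonal fun x => ?_
    by_cases hx : x = fun _ => false
    · subst hx
      simp
    · simp [Pi.single_eq_of_ne hx]
  · simp [vacuumProj, basisProj]

theorem isGreatest_rmsValues_vacuumProj :
    IsGreatest (rmsValues (vacuumProj m)) (√(meanWeightSq fun _ : Fin m => false)) := by
  refine ⟨⟨vacuumProj m, isState_vacuumProj, ?_⟩, ?_⟩
  · rw [secondMoment_vacuumProj, Finset.sum_eq_single fun _ => false]
    · simp [vacuumProj, basisProj]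
    · intro x _ hx
      simp [vacuumProj, basisProj, Ne.symm hx]
    · simp
  · rintro r ⟨σ, ⟨hpos, htr⟩, rfl⟩
    refine Real.sqrt_le_sqrt ?_
    rw [secondMoment_vacuumProj]
    have hsum : ∑ x : Occ m, (σ x x).re = 1 := by
      have := congrArg Complex.re htr
      rwa [Matrix.trace, Complex.re_sum] at this
    -- The diagonal of a state is a probability distribution, so the average is at most the largest
    -- value, the one at the vacuum.
    calc ∑ x : Occ m, (σ x x).re * meanWeightSq x
        ≤ ∑ x : Occ m, (σ x x).re * meanWeightSq fun _ : Fin m => false := by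
          refine Finset.sum_le_sum fun x _ => mul_le_mul_of_nonneg_left (meanWeightSq_le x) ?_
          exact (Complex.le_def.1 hpos.diag_nonneg).1
      _ = _ := by rw [← Finset.sum_mul, hsum, one_mul]

theorem meanWeightSq_vacuum_le (hm : 1 ≤ m) :
    meanWeightSq (fun _ : Fin m => false) ≤ 2 * m := by
  classical
  set N : ℝ := (Fintype.card (Equiv.Perm (Fin (2 * m))) : ℝ) with hN
  have hexpand : meanWeightSq (fun _ : Fin m => false) = (4 ^ m)⁻¹ *
      ∑ T : Finset (Fin m), ∑ T' : Finset (Fin m),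
        ((Fintype.card {p : Equiv.Perm (Fin (2 * m)) //
          IsPaired ((modePairs T).map p.toEmbedding) ∧
          IsPaired ((modePairs T').map p.toEmbedding)} : ℝ) / N) *
        ((pairedProb (modePairs T))⁻¹ * (pairedProb (modePairs T'))⁻¹) := by
    have h4 : ((2 : ℝ) ^ m)⁻¹ ^ 2 = (4 ^ m)⁻¹ := by
      rw [inv_pow, ← pow_mul, mul_comm m 2, pow_mul]
      norm_num
    simp only [meanWeightSq, vacuumWeight, mul_pow, h4, modeSign_vacuum, mul_one]
    rw [← Finset.mul_sum, mul_left_comm]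
    congr 1
    simp only [sq, Finset.sum_mul_sum]
    rw [Finset.sum_comm, Finset.mul_sum]
    refine Finset.sum_congr rfl fun T _ => ?_
    rw [Finset.sum_comm, Finset.mul_sum]
    refine Finset.sum_congr rfl fun T' _ => ?_
    have h5 : ∀ p : Equiv.Perm (Fin (2 * m)),
        ((if IsPaired ((modePairs T).map p.toEmbedding) then
          (pairedProb (modePairs T))⁻¹ else 0) *
        if IsPaired ((modePairs T').map p.toEmbedding) then
          (pairedProb (modePairs T'))⁻¹ else 0) =
        (if IsPaired ((modePairs T).map p.toEmbedding) ∧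
          IsPaired ((modePairs T').map p.toEmbedding) then (1 : ℝ) else 0) *
        ((pairedProb (modePairs T))⁻¹ * (pairedProb (modePairs T'))⁻¹) := by
      intro p
      by_cases h1 : IsPaired ((modePairs T).map p.toEmbedding) <;>
        by_cases h2 : IsPaired ((modePairs T').map p.toEmbedding) <;> simp [h1, h2]
    rw [Finset.sum_congr rfl fun p _ => h5 p, ← Finset.sum_mul, Finset.sum_boole,
      Fintype.card_subtype]
    ring
  rw [hexpand, inv_mul_le_iff₀ (by positivity)]
  refine le_trans (le_of_eq ?_) (sum_pair_dblFactorialRatio_le m hm)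
  refine Finset.sum_congr rfl fun T _ => Finset.sum_congr rfl fun T' _ => ?_
  have hTc : Tᶜ.card = m - T.card := by rw [Finset.card_compl, Fintype.card_fin]
  rw [hN, pairedProb_modePairs_both, pairedProb_modePairs, pairedProb_modePairs, hTc]
  have := dblFactorialRatio_pos m
  have := dblFactorialRatio_pos T.card
  have := dblFactorialRatio_pos T'.card
  have := dblFactorialRatio_pos (m - T.card)
  have := dblFactorialRatio_pos (m - T'.card)
  field_simp

end AffineMatchgate

/-- The measurement channel of the affine-matchgate ensemble on `m ≥ 1` modes is invertible on the
even operators and all snapshots are even, so that the estimator is defined; the maximum that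
defines the shadow norm of the vacuum projector is attained; and this shadow norm is at most
`√(2m)`. -/
theorem mainTheorem3 (m : ℕ) (hm : 1 ≤ m) :
    Set.BijOn (AffineMatchgate.channel m)
        (AffineMatchgate.evenOps m : Set (AffineMatchgate.Op m))
        (AffineMatchgate.evenOps m : Set (AffineMatchgate.Op m)) ∧
      (∀ (p : Equiv.Perm (Fin (2 * m))) (b : AffineMatchgate.Occ m),
        AffineMatchgate.snapshot p b ∈ AffineMatchgate.evenOps m) ∧
      IsGreatest (AffineMatchgate.rmsValues (AffineMatchgate.vacuumProj m))
        (AffineMatchgate.shadowNorm (AffineMatchgate.vacuumProj m)) ∧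
      AffineMatchgate.shadowNorm (AffineMatchgate.vacuumProj m) ≤ √(2 * (m : ℝ)) := by
  have hg := AffineMatchgate.isGreatest_rmsValues_vacuumProj (m := m)
  have hnorm : AffineMatchgate.shadowNorm (AffineMatchgate.vacuumProj m) =
      √(AffineMatchgate.meanWeightSq fun _ : Fin m => false) := hg.csSup_eq
  refine ⟨AffineMatchgate.bijOn_channel_evenOps, AffineMatchgate.snapshot_mem_evenOps, ?_, ?_⟩
  · rw [hnorm]
    exact hg
  · rw [hnorm]
    exact Real.sqrt_le_sqrt (AffineMatchgate.meanWeightSq_vacuum_le hm)
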